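/- **Theorem (Stone, Feller).** Let $c>0$, $\alpha\in(0,2]$, $\beta\in[-1,1]$, and assume that we are not in the case $\alpha=1$, $\beta\neq 0$. Let $h(\alpha,\xi)=\tan(\pi\alpha/2)$ if $\alpha\neq 1$ and $h(1,\xi)=-\frac{2}{\pi}\log|\xi|$, and let $\phi_{c,\alpha,\beta}$ be the stable law, that is, the probability measure on $\mathbb{R}$ with $$\int_{\mathbb{R}} e^{i\xi x}\,\phi_{c,\alpha,\beta}(dx)=e^{\eta_{c,\alpha,\beta}(i\xi)},\qquad \eta_{c,\alpha,\beta}(i\xi)=-|c\xi|^\alpha\bigl(1-i\beta\,h(\alpha,\xi)\,\mathrm{sgn}(\xi)\bigr).$$ Let $\mu$ be a probability measure on $\mathbb{R}$ that is non-lattice (it is not carried by any arithmetic progression $a+b\mathbb{Z}$ with $a\in\mathbb{R}$, $b>0$) and that is in the domain of attraction of $\phi_{c,\alpha,\beta}$ (for some real $A'_n$ and some $B'_n>0$, if $S'_n$ is the sum of $n$ independent random variables with law $\mu$, then $(S'_n-A'_n)/B'_n$ converges in law to $\phi_{c,\alpha,\beta}$). Assume that, in a neighbourhood of $0$, its Fourier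 transform writes as $$\widehat{\mu}(\xi)=\int_{\mathbb{R}}e^{i\xi x}\mu(dx)=\exp\Bigl(im\xi-|c\xi|^\alpha\bigl(1-i\beta\,h(\alpha,\xi)\,\mathrm{sgn}(\xi)\bigr)\,s(\xi)\,(1+\varepsilon(\xi))\Bigr),$$ where $m\in\mathbb{R}$, $\varepsilon$ is complex-valued with $\lim_{\xi\to0}\varepsilon(\xi)=0$, and $s$ is slowly varying at $0$: $s$ is real-valued, positive near $0$ (outside $0$), and $\lim_{\xi\to 0}s(a\xi)/s(\xi)=1$ for every $a\neq0$. Let $A_n=nm$, and let $(B_n)_{n\in\mathbb{N}}$ be a real sequence with $B_n\to+\infty$ and, for all $n$ large enough, $$(B_n)^\alpha=n\,s\!\left(\frac{1}{B_n}\right).$$ Let $S_n=X_1+\cdots+X_n$, where the $X_i$ are independent random variables with law $\mu$. Then $\phi_{c,\alpha,\beta}$ has a continuous density with respect to the Lebesgue measure $m(\cdot)$, namely $p_{c,\alpha,\beta}(x)=\frac1{2\pi}\int_{\mathbb{R}}e^{\eta_{c,\alpha,\beta}(i\xi)-i\xi x}\,d\xi$, and, for every $x\in\mathbb{R}$ and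 every Jordan measurable set $C\subset\mathbb{R}$ (a bounded Borel set whose boundary has Lebesgue measure zero), $$\lim_{n\to\infty}B_n\,\mathbb{P}\bigl[S_n\in A_n+B_nx+C\bigr]=p_{c,\alpha,\beta}(x)\,m(C).$$ -/

import Mathlib

open MeasureTheory ProbabilityTheory Filter Topology

noncomputable section

namespace StoneFeller

/-- The function `h(α, ξ)`: `tan (π α / 2)` if `α ≠ 1`, and `-(2 / π) log |ξ|` if `α = 1`. -/
def stableH (α ξ : ℝ) : ℝ :=
  if α = 1 then -(2 / Real.pi) * Real.log |ξ| else Real.tan (Real.pi * α / 2)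

/-- The factor `|c ξ| ^ α (1 - i β h(α, ξ) sgn ξ)`. -/
def stableSymbol (c α β ξ : ℝ) : ℂ :=
  ((|c * ξ| ^ α : ℝ) : ℂ) *
    (1 - Complex.I * (β : ℂ) * (stableH α ξ : ℂ) * ((Real.sign ξ : ℝ) : ℂ))

/-- The Lévy exponent `ξ ↦ η(i ξ)` of the stable law with parameters `(c, α, β)`. -/
def stableExponent (c α β ξ : ℝ) : ℂ :=
  -stableSymbol c α β ξ

/-- `φ` is the stable law with parameters `(c, α, β)`: the probability measure on the line (unique,
since it is determined by its Fourier transform) such that `∫ exp (i ξ x) φ(dx) = exp (η(i ξ))`. -/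
structure IsStableLaw (φ : Measure ℝ) (c α β : ℝ) : Prop where
  isProbabilityMeasure : IsProbabilityMeasure φ
  charFun_eq : ∀ ξ : ℝ, charFun φ ξ = Complex.exp (stableExponent c α β ξ)

/-- The continuous density of the stable law with parameters `(c, α, β)`, given at every point by
Fourier inversion. -/
def stableDensity (c α β x : ℝ) : ℝ :=
  (1 / (2 * Real.pi)) *
    (∫ ξ : ℝ, Complex.exp (stableExponent c α β ξ - Complex.I * (ξ : ℂ) * (x : ℂ))).re

/-- `p` is a continuous version of the density of `φ` with respect to Lebesgue measure. -/
structure IsContinuousDensity (p : ℝ → ℝ) (φ : Measure ℝ) : Prop where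
  continuous : Continuous p
  nonneg : ∀ y : ℝ, 0 ≤ p y
  eq_withDensity : φ = volume.withDensity (fun y => ENNReal.ofReal (p y))

/-- `μ` is in the domain of attraction of `φ`: if `X₀, X₁, …` are independent with law `μ`
(realized as the coordinates of the infinite product space), then for some centring constants `A n`
and positive scaling constants `B n` the normalized sums `(X₀ + ⋯ + Xₙ₋₁ - A n) / B n` converge in
distribution to `φ`. -/
def InDomainOfAttraction (μ φ : Measure ℝ) [IsProbabilityMeasure μ] [IsProbabilityMeasure φ] :
    Prop :=
  ∃ A B : ℕ → ℝ, (∀ n, 0 < B n) ∧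
    TendstoInDistribution
      (fun (n : ℕ) (X : ℕ → ℝ) => ((∑ i ∈ Finset.range n, X i) - A n) / B n) atTop
      (id : ℝ → ℝ) (fun _ => Measure.infinitePi (fun _ : ℕ => μ)) φ

/-- `μ` is lattice distributed: it is carried by an arithmetic progression `a + b ℤ`, `b > 0`
(Dirac masses are included). -/
def IsLatticeDistributed (μ : Measure ℝ) : Prop :=
  ∃ a b : ℝ, 0 < b ∧ ∀ᵐ x ∂μ, ∃ k : ℤ, x = a + b * (k : ℝ)

/-- `s` is slowly varying at `0` in the sense of Karamata (only its values near `0`, outside `0`,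
matter). -/
structure IsSlowlyVaryingAtZero (s : ℝ → ℝ) : Prop where
  pos : ∀ᶠ ξ in 𝓝[≠] (0 : ℝ), 0 < s ξ
  tendsto : ∀ a : ℝ, a ≠ 0 → Tendsto (fun ξ => s (a * ξ) / s ξ) (𝓝[≠] 0) (𝓝 1)

/-- Jordan measurable subsets of the line: bounded measurable sets whose boundary is Lebesgue
null. -/
structure IsJordanMeasurable (C : Set ℝ) : Prop where
  isBounded : Bornology.IsBounded C
  measurableSet : MeasurableSet C
  frontier_null : volume (frontier C) = 0

end StoneFeller

end

/-!
The proof is Fourier analytic. Write `G(t) = 1 - |charFun μ t|²` (`defect`), and let `T n` be the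
centred sum `S n - n m - B n x`.

*Reduction to characteristic functions.* The measures `B n · law (T n)` are to converge vaguely to
`p(x)` times Lebesgue measure. They are multiplied by a Fejér weight `K`, positive on the bounded
set of interest, whose Fourier transform is a compactly supported triangular function. By Lévy's
continuity theorem for finite measures (`tendsto_real_of_tendsto_weighted_charFun`) it is enough to
follow the characteristic functions of the weighted measures. By Parseval's relation
(`integral_fejer_mul_exp_eq`) these are integrals of the characteristic function of `T n` against a
translate of the triangle, so only bounded frequencies `t` matter, that is `|ξ| = O(B n)` after
the substitution `t = ξ / B n`.

*Pointwise limit.* Slow variation, the choice of `B n` and the homogeneity of the stable exponent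
give `charFun μ (ξ / B n) ^ n * exp (-i n m ξ / B n) → exp (η(i ξ))` (`tendsto_charFun_pow`).

*Domination.* No measurability is assumed on the slowly varying function, so the classical uniform
convergence theorem is not available for it. It is replaced by a property of characteristic
functions: `√G` is subadditive (`sqrt_defect_add_le`). Since `G(ξ) ~ 2 |c ξ|^α s(ξ)`
(`tendsto_defect_div`), `G` grows by a factor at least `2 ^ (α / 2)` at each doubling near the origin, and a
subadditive function with such a dyadic growth satisfies a Potter bound
(`le_rpow_mul_of_subadditive_of_halving`). As `μ` is non-lattice, `G` is bounded below away from the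
origin on compact sets, and the bound extends to every bounded interval
(`defect_le_rpow_mul_defect`). Together with `n G(1 / B n) → 2 c ^ α` this gives the majorant
`exp (-k |ξ| ^ (α / 2))` for `|charFun μ (ξ / B n)| ^ n` on the whole range of integration, and
dominated convergence applies once (`tendsto_integral_tri_mul_charFun_pow`).

The density statement is an instance of a general fact: a law with integrable characteristic
function has the continuous density given by Fourier inversion
(`isContinuousDensity_inversionIntegral`).
-/

namespace StoneFeller

/-! ### Convergence of finite measures through characteristic functions -/

/-- Lévy's continuity theorem for finite measures of varying total mass. -/
theorem tendsto_finiteMeasure_of_tendsto_charFun {ρs : ℕ → FiniteMeasure ℝ} {ρ : FiniteMeasure ℝ}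
    (h : ∀ t : ℝ, Tendsto (fun n => charFun (ρs n : Measure ℝ) t) atTop
      (𝓝 (charFun (ρ : Measure ℝ) t))) :
    Tendsto ρs atTop (𝓝 ρ) := by
  have hmass : Tendsto (fun n => (ρs n).mass) atTop (𝓝 ρ.mass) := by
    have h0 := (Complex.continuous_re.tendsto _).comp (h 0)
    have hm : ∀ σ : FiniteMeasure ℝ, (charFun (σ : Measure ℝ) 0).re = (σ.mass : ℝ) := fun σ => by
      rw [charFun_zero]
      rfl
    rw [← NNReal.tendsto_coe, ← hm]
    exact h0.congr fun n => hm _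
  by_cases hρ : ρ = 0
  · subst hρ
    exact FiniteMeasure.tendsto_zero_of_tendsto_zero_mass (by simpa using hmass)
  refine FiniteMeasure.tendsto_of_tendsto_normalize_testAgainstNN_of_tendsto_mass ?_ hmass
  have key : ∀ (σ : FiniteMeasure ℝ), σ ≠ 0 → ∀ t : ℝ,
      charFun (σ.normalize : Measure ℝ) t = ((σ.mass : ℝ) : ℂ)⁻¹ * charFun (σ : Measure ℝ) t := by
    intro σ hσ t
    rw [FiniteMeasure.toMeasure_normalize_eq_of_nonzero _ hσ, charFun_apply_real,
      charFun_apply_real, integral_smul_nnreal_measure, NNReal.smul_def]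
    simp
  have hρm : ρ.mass ≠ 0 := by simpa using hρ
  have hev : ∀ᶠ n in atTop, ρs n ≠ 0 := by
    filter_upwards [hmass.eventually_ne hρm] with n hn h0
    exact hn (by simp [h0])
  apply ProbabilityMeasure.tendsto_of_tendsto_charFun
  intro t
  rw [key ρ hρ t]
  have hlim : Tendsto (fun n => (((ρs n).mass : ℝ) : ℂ)⁻¹ * charFun (ρs n : Measure ℝ) t) atTop
      (𝓝 (((ρ.mass : ℝ) : ℂ)⁻¹ * charFun (ρ : Measure ℝ) t)) := by
    refine Tendsto.mul (Tendsto.inv₀ ?_ ?_) (h t)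
    · exact (Complex.continuous_ofReal.tendsto _).comp ((NNReal.continuous_coe.tendsto _).comp hmass)
    · simpa using hρm
  refine hlim.congr' ?_
  filter_upwards [hev] with n hn
  rw [key _ hn t]

/-- The portmanteau theorem on continuity sets, for finite measures. -/
theorem tendsto_real_of_null_frontier {ρs : ℕ → FiniteMeasure ℝ} {ρ : FiniteMeasure ℝ}
    (h : Tendsto ρs atTop (𝓝 ρ)) {C : Set ℝ} (hC : (ρ : Measure ℝ) (frontier C) = 0) :
    Tendsto (fun n => (ρs n : Measure ℝ).real C) atTop (𝓝 ((ρ : Measure ℝ).real C)) := by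
  have hcoe : ∀ σ : FiniteMeasure ℝ, (σ : Measure ℝ).real C = ((σ C : NNReal) : ℝ) := fun σ => rfl
  simp_rw [hcoe]
  rw [NNReal.tendsto_coe]
  by_cases hρ : ρ = 0
  · subst hρ
    have hm : Tendsto (fun n => (ρs n).mass) atTop (𝓝 0) := by simpa using h.mass
    simpa using tendsto_of_tendsto_of_tendsto_of_le_of_le tendsto_const_nhds hm
      (fun n => zero_le) (fun n => (ρs n).apply_le_mass C)
  · have hn := (FiniteMeasure.tendsto_normalize_iff_tendsto hρ).2 h
    have h1 : (ρ.normalize) (frontier C) = 0 := by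
      rw [FiniteMeasure.normalize_eq_of_nonzero _ hρ]
      have h0 : ρ (frontier C) = 0 := by
        rw [FiniteMeasure.null_iff_toMeasure_null]
        exact hC
      rw [h0, mul_zero]
    have h2 := ProbabilityMeasure.tendsto_measure_of_null_frontier_of_tendsto hn.1 h1
    have h3 := hn.2.mul h2
    rw [ρ.self_eq_mass_mul_normalize C]
    refine h3.congr fun n => ?_
    rw [(ρs n).self_eq_mass_mul_normalize C]

/-- Weighted form of Lévy's theorem, for measures of possibly infinite mass. If `K` is a weight for
which the measures `K ν n` are finite and their characteristic functions converge to that of `K ν`,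
then `ν n C` converges to `ν C` for every continuity set `C` on which `K` is bounded below. -/
theorem tendsto_real_of_tendsto_weighted_charFun {K : ℝ → ℝ} (hKc : Continuous K)
    (hK0 : ∀ y, 0 ≤ K y) {νs : ℕ → Measure ℝ} {ν : Measure ℝ}
    (hKs : ∀ n, Integrable K (νs n)) (hK : Integrable K ν)
    (h : ∀ u : ℝ, Tendsto (fun n => ∫ y, (K y : ℂ) * Complex.exp (u * y * Complex.I) ∂νs n) atTop
      (𝓝 (∫ y, (K y : ℂ) * Complex.exp (u * y * Complex.I) ∂ν)))
    {C : Set ℝ} (hC : MeasurableSet C) (hfr : ν (frontier C) = 0) {k : ℝ} (hk : 0 < k)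
    (hKC : ∀ y ∈ C, k ≤ K y) :
    Tendsto (fun n => (νs n).real C) atTop (𝓝 (ν.real C)) := by
  have hfin : ∀ σ : Measure ℝ, Integrable K σ →
      IsFiniteMeasure (σ.withDensity fun y => ENNReal.ofReal (K y)) :=
    fun σ hσ => isFiniteMeasure_withDensity_ofReal hσ.2
  have hKm : Measurable fun y => ENNReal.ofReal (K y) := hKc.measurable.ennreal_ofReal
  have hchar : ∀ (σ : Measure ℝ) (t : ℝ),
      charFun (σ.withDensity fun y => ENNReal.ofReal (K y)) t
        = ∫ y, (K y : ℂ) * Complex.exp (t * y * Complex.I) ∂σ := by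
    intro σ t
    rw [charFun_apply_real, integral_withDensity_eq_integral_toReal_smul hKm
      (ae_of_all _ fun _ => ENNReal.ofReal_lt_top)]
    refine integral_congr_ae (ae_of_all _ fun y => ?_)
    simp [ENNReal.toReal_ofReal (hK0 y)]
  let ρs : ℕ → FiniteMeasure ℝ := fun n => ⟨_, hfin _ (hKs n)⟩
  let ρ : FiniteMeasure ℝ := ⟨_, hfin _ hK⟩
  have hρ : Tendsto ρs atTop (𝓝 ρ) := by
    refine tendsto_finiteMeasure_of_tendsto_charFun fun t => ?_
    change Tendsto (fun n => charFun ((νs n).withDensity fun y => ENNReal.ofReal (K y)) t) atTop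
      (𝓝 (charFun (ν.withDensity fun y => ENNReal.ofReal (K y)) t))
    simp_rw [hchar]
    exact h t
  -- Multiplying by the bounded function `1 / max K k` undoes the weight on `C`.
  have hgpos : ∀ y, 0 < max (K y) k := fun y => lt_max_of_lt_right hk
  have hgc : Continuous fun y => (max (K y) k)⁻¹ :=
    (hKc.max continuous_const).inv₀ fun y => (hgpos y).ne'
  have hg0 : ∀ y, 0 ≤ (max (K y) k)⁻¹ := fun y => (inv_pos.2 (hgpos y)).le
  have hgb : ∀ y, ‖(max (K y) k)⁻¹‖ ≤ k⁻¹ := fun y => by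
    rw [Real.norm_of_nonneg (hg0 y)]
    exact inv_anti₀ hk (le_max_right _ _)
  have hgm : Measurable fun y => ENNReal.ofReal (max (K y) k)⁻¹ := hgc.measurable.ennreal_ofReal
  let g : BoundedContinuousFunction ℝ ℝ := BoundedContinuousFunction.ofNormedAddCommGroup _ hgc _ hgb
  have hgfin : ∀ σ : FiniteMeasure ℝ,
      IsFiniteMeasure ((σ : Measure ℝ).withDensity fun y => ENNReal.ofReal (max (K y) k)⁻¹) :=
    fun σ => isFiniteMeasure_withDensity_ofReal (g.integrable (σ : Measure ℝ)).2
  let T : FiniteMeasure ℝ → FiniteMeasure ℝ := fun σ => ⟨_, hgfin σ⟩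
  have hint : ∀ (σ : FiniteMeasure ℝ) (f : BoundedContinuousFunction ℝ ℝ),
      ∫ y, f y ∂(T σ : Measure ℝ) = ∫ y, (g * f) y ∂(σ : Measure ℝ) := by
    intro σ f
    change ∫ y, f y ∂((σ : Measure ℝ).withDensity fun y => ENNReal.ofReal (max (K y) k)⁻¹) = _
    rw [integral_withDensity_eq_integral_toReal_smul hgm
      (ae_of_all _ fun _ => ENNReal.ofReal_lt_top)]
    refine integral_congr_ae (ae_of_all _ fun y => ?_)
    simp only [ENNReal.toReal_ofReal (hg0 y), smul_eq_mul]
    rfl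
  have hT : Tendsto (fun n => T (ρs n)) atTop (𝓝 (T ρ)) := by
    rw [FiniteMeasure.tendsto_iff_forall_integral_tendsto] at hρ ⊢
    intro f
    simp_rw [hint]
    exact hρ (g * f)
  have hval : ∀ (σ : Measure ℝ) (hσ : Integrable K σ),
      (T ⟨_, hfin σ hσ⟩ : Measure ℝ) C = σ C := by
    intro σ hσ
    change ((σ.withDensity fun y => ENNReal.ofReal (K y)).withDensity
      fun y => ENNReal.ofReal (max (K y) k)⁻¹) C = σ C
    rw [withDensity_apply _ hC, setLIntegral_withDensity_eq_setLIntegral_mul _ hKm hgm hC,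
      ← setLIntegral_one]
    refine setLIntegral_congr_fun hC fun y hy => ?_
    have hKy : k ≤ K y := hKC y hy
    simp only [Pi.mul_apply]
    rw [← ENNReal.ofReal_mul (hK0 y), max_eq_left hKy, mul_inv_cancel₀ (hk.trans_le hKy).ne',
      ENNReal.ofReal_one]
  have hfr' : (T ρ : Measure ℝ) (frontier C) = 0 := by
    change ((ν.withDensity fun y => ENNReal.ofReal (K y)).withDensity
      fun y => ENNReal.ofReal (max (K y) k)⁻¹) (frontier C) = 0
    exact withDensity_absolutelyContinuous _ _ (withDensity_absolutelyContinuous _ _ hfr)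
  have hlim := tendsto_real_of_null_frontier hT hfr'
  rw [show (T ρ : Measure ℝ).real C = ν.real C from congrArg ENNReal.toReal (hval ν hK)] at hlim
  exact hlim.congr fun n => congrArg ENNReal.toReal (hval (νs n) (hKs n))

/-! ### Pairing characteristic functions -/

/-- Parseval's relation between two finite measures: a weight `charFun κ` on the line acts on the
characteristic function of `ν` as an average over `κ`. -/
theorem integral_charFun_mul_exp (κ ν : Measure ℝ) [IsFiniteMeasure κ] [IsFiniteMeasure ν] (u : ℝ) :
    ∫ y, charFun κ y * Complex.exp (u * y * Complex.I) ∂ν = ∫ t, charFun ν (t + u) ∂κ := by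
  have hint : Integrable (Function.uncurry fun (y t : ℝ) =>
      Complex.exp (y * t * Complex.I) * Complex.exp (u * y * Complex.I)) (ν.prod κ) := by
    refine Integrable.of_bound (C := 1) (by fun_prop) (ae_of_all _ fun z => ?_)
    simp only [Function.uncurry, norm_mul]
    rw [← Complex.ofReal_mul, ← Complex.ofReal_mul, Complex.norm_exp_ofReal_mul_I,
      Complex.norm_exp_ofReal_mul_I, one_mul]
  simp_rw [charFun_apply_real]
  calc ∫ y, (∫ t, Complex.exp (y * t * Complex.I) ∂κ) * Complex.exp (u * y * Complex.I) ∂ν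
      = ∫ y, ∫ t, Complex.exp (y * t * Complex.I) * Complex.exp (u * y * Complex.I) ∂κ ∂ν := by
        simp_rw [integral_mul_const]
    _ = ∫ t, ∫ y, Complex.exp (y * t * Complex.I) * Complex.exp (u * y * Complex.I) ∂ν ∂κ :=
        integral_integral_swap hint
    _ = _ := by
        refine integral_congr_ae (ae_of_all _ fun t => integral_congr_ae (ae_of_all _ fun y => ?_))
        simp only
        rw [← Complex.exp_add]
        congr 1
        push_cast
        ring

/-! ### Laws with an integrable characteristic function -/

/-- The Fourier inversion integral `∫ f(t) exp (-i t x) dt`, without the factor `1 / (2 π)`, of a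
function `f` on the line. -/
noncomputable def inversionIntegral (f : ℝ → ℂ) (x : ℝ) : ℂ :=
  ∫ t, f t * Complex.exp (-(t * x * Complex.I))

theorem norm_exp_neg_mul_mul_I (t x : ℝ) : ‖Complex.exp (-(t * x * Complex.I))‖ = 1 := by
  rw [← Complex.ofReal_mul, ← neg_mul, ← Complex.ofReal_neg, Complex.norm_exp_ofReal_mul_I]

theorem integrable_mul_exp_neg {f : ℝ → ℂ} (hf : Integrable f) (x : ℝ) :
    Integrable fun t : ℝ => f t * Complex.exp (-(t * x * Complex.I)) := by
  refine hf.mul_bdd (c := 1) (by fun_prop) (ae_of_all _ fun t => ?_)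
  rw [norm_exp_neg_mul_mul_I]

theorem continuous_inversionIntegral {f : ℝ → ℂ} (hf : Integrable f) :
    Continuous (inversionIntegral f) := by
  refine continuous_of_dominated (bound := fun t => ‖f t‖) (fun x => ?_) (fun x => ?_) hf.norm ?_
  · exact (integrable_mul_exp_neg hf x).aestronglyMeasurable
  · exact ae_of_all _ fun t => by rw [norm_mul, norm_exp_neg_mul_mul_I, mul_one]
  · exact ae_of_all _ fun t => by fun_prop

theorem norm_inversionIntegral_le (f : ℝ → ℂ) (x : ℝ) : ‖inversionIntegral f x‖ ≤ ∫ t, ‖f t‖ := by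
  refine (norm_integral_le_integral_norm _).trans_eq ?_
  refine integral_congr_ae (ae_of_all _ fun t => ?_)
  simp only [norm_mul, norm_exp_neg_mul_mul_I, mul_one]

theorem sqrt_mul_gaussianPDFReal {v : NNReal} (hv : v ≠ 0) (t : ℝ) :
    √(2 * Real.pi * v) * gaussianPDFReal 0 v t = Real.exp (-(t ^ 2) / (2 * v)) := by
  have hvpos : (0 : ℝ) < 2 * Real.pi * v := by positivity
  rw [gaussianPDFReal, mul_inv_cancel_left₀ (Real.sqrt_pos.2 hvpos).ne', sub_zero]

/-- The Gaussian averages `√(2πv) ∫ exp (-v (y - x)² / 2) φ(dy)` are nonnegative and converge to the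
inversion integral as `v → ∞`. -/
theorem inversionIntegral_charFun_nonneg (φ : Measure ℝ) [IsProbabilityMeasure φ]
    (hφ : Integrable (charFun φ)) (x : ℝ) :
    0 ≤ (inversionIntegral (charFun φ) x).re ∧ (inversionIntegral (charFun φ) x).im = 0 := by
  have hlim : Tendsto (fun n : ℕ => ∫ t : ℝ, ((Real.exp (-(t ^ 2) / (2 * (n + 1))) : ℝ) : ℂ) *
      (charFun φ t * Complex.exp (-(t * x * Complex.I)))) atTop
      (𝓝 (inversionIntegral (charFun φ) x)) := by
    refine tendsto_integral_of_dominated_convergence (fun t => ‖charFun φ t‖) (fun n => ?_)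
      hφ.norm (fun n => ae_of_all _ fun t => ?_) (ae_of_all _ fun t => ?_)
    · exact (Continuous.aestronglyMeasurable (by fun_prop)).mul
        (integrable_mul_exp_neg hφ x).aestronglyMeasurable
    · rw [norm_mul, norm_mul, norm_exp_neg_mul_mul_I, mul_one, Complex.norm_real,
        Real.norm_of_nonneg (Real.exp_pos _).le]
      refine mul_le_of_le_one_left (norm_nonneg _) (Real.exp_le_one_iff.2 ?_)
      rw [neg_div]
      exact neg_nonpos.2 (by positivity)
    · have h1 : Tendsto (fun n : ℕ => -(t ^ 2) / 2 * (1 / ((n : ℝ) + 1))) atTop (𝓝 0) := by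
        simpa using (tendsto_one_div_add_atTop_nhds_zero_nat (𝕜 := ℝ)).const_mul (-(t ^ 2) / 2)
      have h2 := (Complex.continuous_ofReal.tendsto _).comp ((Real.continuous_exp.tendsto _).comp h1)
      have h3 := h2.mul_const (charFun φ t * Complex.exp (-(t * x * Complex.I)))
      rw [Real.exp_zero, Complex.ofReal_one, one_mul] at h3
      refine h3.congr fun n => ?_
      simp only [Function.comp_apply]
      rw [mul_one_div, div_div]
  have hval : ∀ n : ℕ, ∃ r : ℝ, 0 ≤ r ∧
      ∫ t : ℝ, ((Real.exp (-(t ^ 2) / (2 * (n + 1))) : ℝ) : ℂ) *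
        (charFun φ t * Complex.exp (-(t * x * Complex.I))) = (r : ℂ) := by
    intro n
    set v : NNReal := (n : NNReal) + 1 with hv
    have hv0 : v ≠ 0 := by positivity
    have hvr : (v : ℝ) = n + 1 := by simp [hv]
    have hpair := integral_charFun_mul_exp (gaussianReal 0 v) (φ.map (· + -x)) 0
    simp only [Complex.ofReal_zero, zero_mul, Complex.exp_zero, mul_one, add_zero] at hpair
    rw [integral_gaussianReal_eq_integral_smul hv0] at hpair
    refine ⟨√(2 * Real.pi * v) * ∫ y, Real.exp (-(v * y ^ 2 / 2)) ∂(φ.map (· + -x)),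
      mul_nonneg (Real.sqrt_nonneg _) (integral_nonneg fun y => (Real.exp_pos _).le), ?_⟩
    have hK : ∀ y : ℝ, charFun (gaussianReal 0 v) y = ((Real.exp (-(v * y ^ 2 / 2)) : ℝ) : ℂ) := by
      intro y
      rw [charFun_gaussianReal]
      push_cast
      congr 1
      ring
    simp_rw [hK] at hpair
    rw [integral_complex_ofReal] at hpair
    rw [Complex.ofReal_mul, hpair, ← integral_const_mul]
    refine integral_congr_ae (ae_of_all _ fun t => ?_)
    simp only [charFun_map_add_const, Complex.real_smul]
    rw [← mul_assoc ((√(2 * Real.pi * v) : ℝ) : ℂ), ← Complex.ofReal_mul (√(2 * Real.pi * v)),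
      sqrt_mul_gaussianPDFReal hv0, hvr]
    congr 3
    simp
  choose r hr0 hr using hval
  simp_rw [hr] at hlim
  have hre := (Complex.continuous_re.tendsto _).comp hlim
  have him := (Complex.continuous_im.tendsto _).comp hlim
  simp only [Function.comp_def, Complex.ofReal_re, Complex.ofReal_im] at hre him
  exact ⟨ge_of_tendsto' hre hr0, tendsto_nhds_unique him tendsto_const_nhds⟩

/-- The Fourier transform of the Gaussian weight `exp (-y² / 2)`. -/
theorem integral_gaussian_mul_exp (s : ℝ) :
    ∫ y : ℝ, ((Real.exp (-(y ^ 2 / 2)) : ℝ) : ℂ) * Complex.exp (s * y * Complex.I)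
      = (2 * Real.pi : ℝ) * (gaussianPDFReal 0 1 s : ℂ) := by
  have h := charFun_gaussianReal (μ := 0) (v := 1) s
  rw [charFun_apply_real, integral_gaussianReal_eq_integral_smul one_ne_zero] at h
  have h3 : ((2 * Real.pi : ℝ) : ℂ) = (√(2 * Real.pi) : ℝ) * (√(2 * Real.pi) : ℝ) := by
    rw [← Complex.ofReal_mul, Real.mul_self_sqrt (by positivity)]
  have h4 : ∀ y : ℝ, ((√(2 * Real.pi) : ℝ) : ℂ) * (gaussianPDFReal 0 1 y : ℂ)
      = ((Real.exp (-(y ^ 2 / 2)) : ℝ) : ℂ) := by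
    intro y
    have h5 := sqrt_mul_gaussianPDFReal one_ne_zero y
    simp only [NNReal.coe_one, mul_one] at h5
    rw [← Complex.ofReal_mul, h5, neg_div]
  simp_rw [Complex.real_smul] at h
  simp_rw [← h4, mul_assoc ((√(2 * Real.pi) : ℝ) : ℂ)]
  rw [integral_const_mul, h, h3, mul_assoc ((√(2 * Real.pi) : ℝ) : ℂ) ((√(2 * Real.pi) : ℝ) : ℂ), h4]
  congr 1
  push_cast
  congr 1
  ring

/-- A probability measure with integrable characteristic function has the continuous density given
by Fourier inversion. Both measures are compared after multiplication by the positive weight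
`exp (-y² / 2)`, which makes the inversion integral integrable. -/
theorem isContinuousDensity_inversionIntegral (φ : Measure ℝ) [IsProbabilityMeasure φ]
    (hφ : Integrable (charFun φ)) :
    IsContinuousDensity (fun x => 1 / (2 * Real.pi) * (inversionIntegral (charFun φ) x).re) φ := by
  have hpi := Real.pi_pos
  have hcont : Continuous fun x => 1 / (2 * Real.pi) * (inversionIntegral (charFun φ) x).re :=
    continuous_const.mul (Complex.continuous_re.comp (continuous_inversionIntegral hφ))
  have hnn : ∀ x, 0 ≤ 1 / (2 * Real.pi) * (inversionIntegral (charFun φ) x).re := fun x =>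
    mul_nonneg (by positivity) (inversionIntegral_charFun_nonneg φ hφ x).1
  refine ⟨hcont, hnn, ?_⟩
  set p : ℝ → ℝ := fun x => 1 / (2 * Real.pi) * (inversionIntegral (charFun φ) x).re with hp
  have hp0 : ∀ x, 0 ≤ p x := hnn
  have hpI : ∀ x, ((2 * Real.pi : ℝ) : ℂ) * (p x : ℂ) = inversionIntegral (charFun φ) x := by
    intro x
    apply Complex.ext
    · rw [← Complex.ofReal_mul, Complex.ofReal_re, hp]
      field_simp
    · rw [← Complex.ofReal_mul, Complex.ofReal_im, (inversionIntegral_charFun_nonneg φ hφ x).2]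
  set K : ℝ → ℝ := fun y => Real.exp (-(y ^ 2 / 2)) with hKdef
  have hK0 : ∀ y, 0 < K y := fun y => Real.exp_pos _
  have hKc : Continuous K := by fun_prop
  have hKint : Integrable K := by
    have := integrable_exp_neg_mul_sq (b := 1 / 2) (by norm_num)
    refine this.congr (ae_of_all _ fun y => ?_)
    simp only [hKdef]
    congr 1
    ring
  have hKm : Measurable fun y => ENNReal.ofReal (K y) := hKc.measurable.ennreal_ofReal
  have hpm : Measurable fun y => ENNReal.ofReal (p y) := hcont.measurable.ennreal_ofReal
  have hpKint : Integrable fun y => p y * K y := by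
    refine hKint.bdd_mul (c := 1 / (2 * Real.pi) * ∫ t, ‖charFun φ t‖)
      hcont.aestronglyMeasurable (ae_of_all _ fun y => ?_)
    rw [Real.norm_of_nonneg (hp0 y)]
    exact mul_le_mul_of_nonneg_left ((Complex.re_le_norm _).trans (norm_inversionIntegral_le _ _))
      (by positivity)
  have hchar : ∀ (σ : Measure ℝ) (t : ℝ),
      charFun (σ.withDensity fun y => ENNReal.ofReal (K y)) t
        = ∫ y : ℝ, (K y : ℂ) * Complex.exp (t * y * Complex.I) ∂σ := by
    intro σ t
    rw [charFun_apply_real, integral_withDensity_eq_integral_toReal_smul hKm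
      (ae_of_all _ fun _ => ENNReal.ofReal_lt_top)]
    refine integral_congr_ae (ae_of_all _ fun y => ?_)
    simp [ENNReal.toReal_ofReal (hK0 y).le]
  have hfin1 : IsFiniteMeasure (φ.withDensity fun y => ENNReal.ofReal (K y)) := by
    refine isFiniteMeasure_withDensity_ofReal (Integrable.of_bound (C := 1)
      hKc.aestronglyMeasurable (ae_of_all _ fun y => ?_)).2
    rw [Real.norm_of_nonneg (hK0 y).le]
    exact Real.exp_le_one_iff.2 (neg_nonpos.2 (by positivity))
  have hfin2 : IsFiniteMeasure ((volume.withDensity fun y => ENNReal.ofReal (p y)).withDensity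
      fun y => ENNReal.ofReal (K y)) := by
    rw [← withDensity_mul _ hpm hKm]
    have : ((fun y => ENNReal.ofReal (p y)) * fun y => ENNReal.ofReal (K y))
        = fun y => ENNReal.ofReal (p y * K y) := by
      ext y
      rw [Pi.mul_apply, ENNReal.ofReal_mul (hp0 y)]
    rw [this]
    exact isFiniteMeasure_withDensity_ofReal hpKint.2
  have hKg : ∀ y : ℝ, charFun (gaussianReal 0 1) y = (K y : ℂ) := by
    intro y
    rw [charFun_gaussianReal, hKdef]
    push_cast
    congr 1
    ring
  have hkey : φ.withDensity (fun y => ENNReal.ofReal (K y))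
      = (volume.withDensity fun y => ENNReal.ofReal (p y)).withDensity
        fun y => ENNReal.ofReal (K y) := by
    refine Measure.ext_of_charFun (funext fun u => ?_)
    rw [hchar, hchar, integral_withDensity_eq_integral_toReal_smul hpm
      (ae_of_all _ fun _ => ENNReal.ofReal_lt_top)]
    have hpair := integral_charFun_mul_exp (gaussianReal 0 1) φ u
    simp_rw [hKg] at hpair
    rw [hpair, integral_gaussianReal_eq_integral_smul one_ne_zero]
    have h2pi : ((2 * Real.pi : ℝ) : ℂ) ≠ 0 := by
      rw [Complex.ofReal_ne_zero]
      positivity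
    apply mul_left_cancel₀ h2pi
    have hint : Integrable (Function.uncurry fun (y t : ℝ) =>
        (charFun φ t * Complex.exp (-(t * y * Complex.I))) *
          ((K y : ℂ) * Complex.exp (u * y * Complex.I))) (volume.prod volume) := by
      have h1 : Integrable (fun z : ℝ × ℝ => (K z.1 : ℂ) * charFun φ z.2) (volume.prod volume) :=
        (hKint.ofReal (𝕜 := ℂ)).mul_prod hφ
      have h2 := h1.mul_bdd (c := 1) (g := fun z : ℝ × ℝ =>
        Complex.exp (-(z.2 * z.1 * Complex.I)) * Complex.exp (u * z.1 * Complex.I))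
        (by fun_prop) (ae_of_all _ fun z => by
          rw [norm_mul, norm_exp_neg_mul_mul_I, ← Complex.ofReal_mul,
            Complex.norm_exp_ofReal_mul_I, one_mul])
      refine h2.congr (ae_of_all _ fun z => ?_)
      simp only [Function.uncurry]
      ring
    calc ((2 * Real.pi : ℝ) : ℂ) * ∫ t, gaussianPDFReal 0 1 t • charFun φ (t + u)
        = ∫ t, ((2 * Real.pi : ℝ) : ℂ) * (gaussianPDFReal 0 1 (u - t) * charFun φ t) := by
          rw [integral_const_mul, 
            ← integral_add_right_eq_self
              (fun t : ℝ => (gaussianPDFReal 0 1 (u - t) : ℂ) * charFun φ t) u]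
          congr 1
          refine integral_congr_ae (ae_of_all _ fun t => ?_)
          simp only [Complex.real_smul, gaussianPDFReal]
          congr 4
          ring
      _ = ∫ t, charFun φ t *
            ∫ y : ℝ, (K y : ℂ) * Complex.exp (((u - t : ℝ) : ℂ) * y * Complex.I) := by
          refine integral_congr_ae (ae_of_all _ fun t => ?_)
          simp only [hKdef, integral_gaussian_mul_exp]
          ring
      _ = ∫ t : ℝ, ∫ y : ℝ, (charFun φ t * Complex.exp (-(t * y * Complex.I))) *
            ((K y : ℂ) * Complex.exp (u * y * Complex.I)) := by
          refine integral_congr_ae (ae_of_all _ fun t => ?_)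
          simp only
          rw [← integral_const_mul]
          refine integral_congr_ae (ae_of_all _ fun y => ?_)
          have he : Complex.exp (((u - t : ℝ) : ℂ) * y * Complex.I)
              = Complex.exp (-(t * y * Complex.I)) * Complex.exp (u * y * Complex.I) := by
            rw [← Complex.exp_add]
            congr 1
            push_cast
            ring
          simp only [he]
          ring
      _ = ∫ y : ℝ, ∫ t : ℝ, (charFun φ t * Complex.exp (-(t * y * Complex.I))) *
            ((K y : ℂ) * Complex.exp (u * y * Complex.I)) := (integral_integral_swap hint).symm
      _ = ∫ y : ℝ, inversionIntegral (charFun φ) y *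
            ((K y : ℂ) * Complex.exp (u * y * Complex.I)) := by
          refine integral_congr_ae (ae_of_all _ fun y => ?_)
          simp only [integral_mul_const, inversionIntegral]
      _ = _ := by
          rw [← integral_const_mul]
          refine integral_congr_ae (ae_of_all _ fun y => ?_)
          simp only [← hpI, ENNReal.toReal_ofReal (hp0 y), Complex.real_smul]
          ring
  have hne : ∀ y, ENNReal.ofReal (K y) ≠ 0 := fun y => (ENNReal.ofReal_pos.2 (hK0 y)).ne'
  have hinv : ∀ σ : Measure ℝ, (σ.withDensity fun y => ENNReal.ofReal (K y)).withDensity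
      (fun y => ENNReal.ofReal (K y))⁻¹ = σ := fun σ =>
    withDensity_inv_same hKm (ae_of_all _ hne) (ae_of_all _ fun _ => ENNReal.ofReal_ne_top)
  exact (hinv φ).symm.trans ((congrArg (fun σ : Measure ℝ =>
    σ.withDensity (fun y => ENNReal.ofReal (K y))⁻¹) hkey).trans (hinv _))

/-! ### The triangular function and its Fourier transform -/

/-- The triangular function `t ↦ (a - |t|)⁺`, supported in `[-a, a]`. -/
noncomputable def tri (a t : ℝ) : ℝ := max 0 (a - |t|)

/-- The Fejér weight `y ↦ (a sinc (a y / 2))²`, the Fourier transform of `tri a`. -/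
noncomputable def fejer (a y : ℝ) : ℝ := (a * Real.sinc (a * y / 2)) ^ 2

theorem tri_nonneg (a t : ℝ) : 0 ≤ tri a t := le_max_left _ _

theorem tri_neg (a t : ℝ) : tri a (-t) = tri a t := by simp [tri]

theorem continuous_tri (a : ℝ) : Continuous (tri a) := by unfold tri; fun_prop

theorem tri_le {a : ℝ} (ha : 0 ≤ a) (t : ℝ) : tri a t ≤ a :=
  max_le ha (by linarith [abs_nonneg t])

theorem tri_eq_zero {a t : ℝ} (h : a ≤ |t|) : tri a t = 0 := max_eq_left (by linarith)

theorem integrable_tri (a : ℝ) : Integrable (tri a) := by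
  refine (continuous_tri a).integrable_of_hasCompactSupport
    (HasCompactSupport.of_support_subset_isCompact (isCompact_Icc (a := -a) (b := a)) ?_)
  intro t ht
  rw [Set.mem_Icc, ← abs_le]
  by_contra h
  exact ht (tri_eq_zero (not_le.1 h).le)

theorem fejer_nonneg (a y : ℝ) : 0 ≤ fejer a y := sq_nonneg _

theorem continuous_fejer (a : ℝ) : Continuous (fejer a) := by unfold fejer; fun_prop

theorem fejer_le (a y : ℝ) : fejer a y ≤ a ^ 2 := by
  rw [fejer, mul_pow]
  refine mul_le_of_le_one_right (sq_nonneg _) ?_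
  rw [← sq_abs]
  exact pow_le_one₀ (abs_nonneg _) (Real.abs_sinc_le_one _)

theorem fejer_mul_sq_le {a : ℝ} (ha : 0 < a) (y : ℝ) : fejer a y * y ^ 2 ≤ 4 := by
  rcases eq_or_ne y 0 with rfl | hy
  · norm_num
  · have h : fejer a y * y ^ 2 = 4 * Real.sin (a * y / 2) ^ 2 := by
      rw [fejer, Real.sinc_of_ne_zero (by positivity)]
      field_simp
      ring
    rw [h]
    nlinarith [Real.sin_sq_le_one (a * y / 2)]

theorem integrable_fejer {a : ℝ} (ha : 0 < a) : Integrable (fejer a) := by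
  refine (integrable_inv_one_add_sq.const_mul (a ^ 2 + 4)).mono'
    (continuous_fejer a).aestronglyMeasurable (ae_of_all _ fun y => ?_)
  rw [Real.norm_of_nonneg (fejer_nonneg a y), ← div_eq_mul_inv, le_div_iff₀ (by positivity)]
  nlinarith [fejer_le a y, fejer_mul_sq_le ha y]

theorem fejer_pos {a y : ℝ} (ha : 0 < a) (hy : a * |y| < 2 * Real.pi) : 0 < fejer a y := by
  rcases eq_or_ne y 0 with rfl | hy0
  · simp [fejer, ha]
  · have h1 : 0 < |a * y / 2| := abs_pos.2 (by positivity)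
    have h2 : |a * y / 2| < Real.pi := by
      rw [abs_div, abs_mul, abs_of_pos ha, abs_two]
      linarith
    have h3 : Real.sin (a * y / 2) ≠ 0 := by
      rw [← abs_ne_zero, Real.abs_sin_eq_sin_abs_of_abs_le_pi h2.le]
      exact (Real.sin_pos_of_pos_of_lt_pi h1 h2).ne'
    rw [fejer, Real.sinc_of_ne_zero (by positivity)]
    positivity

/-- The cosine transform of the triangular function, from an explicit primitive. -/
theorem intervalIntegral_tri_mul_cos {a : ℝ} (ha : 0 < a) (y : ℝ) :
    2 * ∫ t in (0 : ℝ)..a, (a - t) * Real.cos (y * t) = fejer a y := by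
  rcases eq_or_ne y 0 with rfl | hy
  · have : ∫ t in (0 : ℝ)..a, (a - t) = a ^ 2 / 2 := by
      rw [intervalIntegral.integral_sub (by simp) (by simp)]
      simp
      ring
    simp [fejer, this]
    ring
  have hd : ∀ t ∈ Set.uIcc 0 a, HasDerivAt
      (fun t => (a - t) * Real.sin (y * t) / y - Real.cos (y * t) / y ^ 2)
      ((a - t) * Real.cos (y * t)) t := by
    intro t _
    have h1 : HasDerivAt (fun t => y * t) y t := by simpa using (hasDerivAt_id t).const_mul y
    have h2 := (((hasDerivAt_id t).const_sub a).mul h1.sin).div_const y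
    have h3 := h1.cos.div_const (y ^ 2)
    refine (h2.sub h3).congr_deriv ?_
    simp only [id]
    field_simp
    ring
  rw [intervalIntegral.integral_eq_sub_of_hasDerivAt hd
    (Continuous.intervalIntegrable (by fun_prop) _ _)]
  have hc : Real.cos (y * a) = 1 - 2 * Real.sin (a * y / 2) ^ 2 := by
    rw [show y * a = 2 * (a * y / 2) by ring, Real.cos_two_mul, Real.sin_sq]
    ring
  rw [hc, fejer, Real.sinc_of_ne_zero (by positivity)]
  simp
  field_simp
  ring

theorem integral_tri_mul_exp {a : ℝ} (ha : 0 < a) (y : ℝ) :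
    ∫ t : ℝ, (tri a t : ℂ) * Complex.exp (y * t * Complex.I) = fejer a y := by
  have hint : Integrable fun t : ℝ => (tri a t : ℂ) * Complex.exp (y * t * Complex.I) := by
    refine (integrable_tri a).ofReal.mul_bdd (c := 1) (by fun_prop) (ae_of_all _ fun t => ?_)
    rw [← Complex.ofReal_mul, Complex.norm_exp_ofReal_mul_I]
  have hcos : ∀ t : ℝ, ((tri a t : ℂ) * Complex.exp (y * t * Complex.I)).re
      = tri a |t| * Real.cos (y * |t|) := by
    intro t
    rw [← Complex.ofReal_mul, Complex.re_ofReal_mul, Complex.exp_ofReal_mul_I_re]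
    congr 1
    · simp [tri]
    · rcases abs_cases t with h | h <;> rw [h.1]
      rw [mul_neg, Real.cos_neg]
  have him : (∫ t : ℝ, (tri a t : ℂ) * Complex.exp (y * t * Complex.I)).im = 0 := by
    rw [← Complex.conj_eq_iff_im, ← integral_conj, ← integral_neg_eq_self]
    refine integral_congr_ae (ae_of_all _ fun t => ?_)
    simp only [map_mul, Complex.conj_ofReal, ← Complex.exp_conj, tri_neg, Complex.conj_I]
    congr 2
    push_cast
    ring
  apply Complex.ext
  · rw [Complex.ofReal_re, ← RCLike.re_eq_complex_re, ← integral_re hint]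
    simp only [RCLike.re_eq_complex_re, hcos]
    rw [integral_comp_abs (f := fun t => tri a t * Real.cos (y * t)),
      ← intervalIntegral_tri_mul_cos ha, intervalIntegral.integral_of_le ha.le]
    congr 1
    rw [setIntegral_eq_of_subset_of_forall_sdiff_eq_zero measurableSet_Ioi
      (Set.Ioc_subset_Ioi_self (a := a) (b := 0))]
    · refine setIntegral_congr_fun measurableSet_Ioc fun t ht => ?_
      simp only [tri, abs_of_pos ht.1]
      rw [max_eq_right (by linarith [ht.2])]
    · intro t ht
      have hat : a ≤ t := by
        by_contra h
        exact ht.2 ⟨ht.1, (not_le.1 h).le⟩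
      rw [tri_eq_zero (hat.trans (le_abs_self t)), zero_mul]
  · rw [him, Complex.ofReal_im]

open scoped FourierTransform in
/-- Fourier inversion for the pair `tri a`, `fejer a`. -/
theorem integral_fejer_mul_exp {a : ℝ} (ha : 0 < a) (u : ℝ) :
    ∫ y : ℝ, (fejer a y : ℂ) * Complex.exp (u * y * Complex.I)
      = (2 * Real.pi : ℝ) * (tri a u : ℂ) := by
  have h2pi : (0 : ℝ) < 2 * Real.pi := by positivity
  have heven : ∀ y, fejer a (-y) = fejer a y := fun y => by
    rw [fejer, fejer, mul_neg, neg_div, Real.sinc_neg]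
  have hF : 𝓕 (fun t : ℝ => (tri a t : ℂ)) = fun w => (fejer a (2 * Real.pi * w) : ℂ) := by
    funext w
    rw [Real.fourier_real_eq_integral_exp_smul, ← heven, ← integral_tri_mul_exp ha]
    refine integral_congr_ae (ae_of_all _ fun t => ?_)
    simp only [smul_eq_mul]
    rw [mul_comm]
    congr 3
    push_cast
    ring
  have hinv := Continuous.fourierInv_fourier_eq
    (Complex.continuous_ofReal.comp (continuous_tri a)) (integrable_tri a).ofReal (by
      change Integrable (𝓕 (fun t : ℝ => (tri a t : ℂ)))
      rw [hF]
      exact ((integrable_fejer ha).comp_mul_left' h2pi.ne').ofReal)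
  have hu := congrFun hinv u
  change 𝓕⁻ (𝓕 (fun t : ℝ => (tri a t : ℂ))) u = (tri a u : ℂ) at hu
  rw [hF, Real.fourierInv_eq'] at hu
  have hsub := Measure.integral_comp_mul_left
    (fun y : ℝ => (fejer a y : ℂ) * Complex.exp (u * y * Complex.I)) (2 * Real.pi)
  rw [← hu, eq_comm]
  rw [abs_of_pos (inv_pos.2 h2pi), eq_comm, inv_smul_eq_iff₀ h2pi.ne'] at hsub
  rw [hsub, Complex.real_smul]
  congr 1
  refine integral_congr_ae (ae_of_all _ fun t => ?_)
  simp only [smul_eq_mul]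
  rw [mul_comm]
  congr 2
  simp
  ring

/-! ### Subadditivity and regular growth of the defect of a characteristic function -/

/-- The defect `1 - |charFun μ t|²` of the characteristic function from having modulus one; it is
`1 - charFun ν t`, where `ν` is the law of the difference of two independent copies of `μ`. -/
noncomputable def defect (μ : Measure ℝ) (t : ℝ) : ℝ := 1 - ‖charFun μ t‖ ^ 2

theorem defect_neg (μ : Measure ℝ) (t : ℝ) : defect μ (-t) = defect μ t := by simp [defect]

theorem defect_abs (μ : Measure ℝ) (t : ℝ) : defect μ |t| = defect μ t := by
  rcases abs_choice t with h | h <;> rw [h]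
  exact defect_neg μ t

section Defect

variable (μ : Measure ℝ) [IsProbabilityMeasure μ]

theorem continuous_defect : Continuous (defect μ) := by
  have : Continuous (charFun μ) := continuous_charFun
  unfold defect
  fun_prop

theorem defect_nonneg (t : ℝ) : 0 ≤ defect μ t := by
  have h := norm_charFun_le_one (μ := μ) t
  have := pow_le_one₀ (n := 2) (norm_nonneg _) h
  rw [defect]
  linarith

theorem defect_zero : defect μ 0 = 0 := by simp [defect]

theorem integrable_sin_sq (t : ℝ) :
    Integrable (fun z : ℝ × ℝ => Real.sin (t * (z.1 - z.2) / 2) ^ 2) (μ.prod μ) := by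
  refine Integrable.of_bound (C := 1) (by fun_prop) (ae_of_all _ fun z => ?_)
  rw [Real.norm_of_nonneg (sq_nonneg _)]
  exact Real.sin_sq_le_one _

theorem defect_eq_integral (t : ℝ) :
    defect μ t = ∫ z : ℝ × ℝ, 2 * Real.sin (t * (z.1 - z.2) / 2) ^ 2 ∂(μ.prod μ) := by
  have h1 : ((‖charFun μ t‖ ^ 2 : ℝ) : ℂ)
      = ∫ z : ℝ × ℝ, Complex.exp ((t * (z.1 - z.2) : ℝ) * Complex.I) ∂(μ.prod μ) := by
    rw [Complex.ofReal_pow, ← Complex.mul_conj', ← charFun_neg, charFun_apply_real,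
      charFun_apply_real, ← integral_prod_mul]
    refine integral_congr_ae (ae_of_all _ fun z => ?_)
    simp only
    rw [← Complex.exp_add]
    congr 1
    push_cast
    ring
  have hint : Integrable (fun z : ℝ × ℝ => Complex.exp ((t * (z.1 - z.2) : ℝ) * Complex.I))
      (μ.prod μ) := by
    refine Integrable.of_bound (C := 1) (by fun_prop) (ae_of_all _ fun z => ?_)
    rw [Complex.norm_exp_ofReal_mul_I]
  have h2 : ‖charFun μ t‖ ^ 2 = ∫ z : ℝ × ℝ, Real.cos (t * (z.1 - z.2)) ∂(μ.prod μ) := by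
    have h3 := congrArg Complex.re h1
    rw [Complex.ofReal_re, ← RCLike.re_eq_complex_re, ← integral_re hint] at h3
    rw [h3]
    refine integral_congr_ae (ae_of_all _ fun z => ?_)
    simp only [RCLike.re_eq_complex_re, Complex.exp_ofReal_mul_I_re]
  rw [defect, h2, eq_comm]
  have h4 : ∀ z : ℝ × ℝ, 2 * Real.sin (t * (z.1 - z.2) / 2) ^ 2
      = 1 - Real.cos (t * (z.1 - z.2)) := by
    intro z
    rw [Real.sin_sq_eq_half_sub, mul_div_cancel₀ _ (two_ne_zero)]
    ring
  simp_rw [h4]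
  rw [integral_sub (integrable_const _) (Integrable.of_bound (C := 1) (by fun_prop)
    (ae_of_all _ fun z => by simpa using Real.abs_cos_le_one _))]
  simp

/-- The quadratic form of subadditivity, integrated from
`|sin (a + b)| ≤ |sin a| + |sin b|`. -/
theorem defect_add_le (s t : ℝ) {θ : ℝ} (hθ : 0 < θ) :
    defect μ (s + t) ≤ (1 + θ) * defect μ s + (1 + θ⁻¹) * defect μ t := by
  rw [defect_eq_integral, defect_eq_integral μ s, defect_eq_integral μ t, ← integral_const_mul,
    ← integral_const_mul, ← integral_add (((integrable_sin_sq μ s).const_mul _).const_mul _)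
      (((integrable_sin_sq μ t).const_mul _).const_mul _)]
  refine integral_mono ((integrable_sin_sq μ _).const_mul _)
    ((((integrable_sin_sq μ s).const_mul _).const_mul _).add
      (((integrable_sin_sq μ t).const_mul _).const_mul _)) fun z => ?_
  simp only
  set A := s * (z.1 - z.2) / 2
  set D := t * (z.1 - z.2) / 2
  rw [show (s + t) * (z.1 - z.2) / 2 = A + D by simp only [A, D]; ring]
  have h1 : |Real.sin (A + D)| ≤ |Real.sin A| + |Real.sin D| := by
    rw [Real.sin_add]
    refine (abs_add_le _ _).trans (add_le_add ?_ ?_)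
    · rw [abs_mul]
      exact mul_le_of_le_one_right (abs_nonneg _) (Real.abs_cos_le_one _)
    · rw [abs_mul]
      exact mul_le_of_le_one_left (abs_nonneg _) (Real.abs_cos_le_one _)
  have h2 : Real.sin (A + D) ^ 2 ≤ (|Real.sin A| + |Real.sin D|) ^ 2 := by
    rw [← sq_abs (Real.sin (A + D))]
    exact pow_le_pow_left₀ (abs_nonneg _) h1 2
  have h3 : (|Real.sin A| + |Real.sin D|) ^ 2
      ≤ (1 + θ) * Real.sin A ^ 2 + (1 + θ⁻¹) * Real.sin D ^ 2 := by
    have h4 : 0 ≤ θ⁻¹ * (θ * |Real.sin A| - |Real.sin D|) ^ 2 := by positivity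
    have h5 : θ⁻¹ * (θ * |Real.sin A| - |Real.sin D|) ^ 2
        = θ * Real.sin A ^ 2 + θ⁻¹ * Real.sin D ^ 2 - 2 * |Real.sin A| * |Real.sin D| := by
      rw [← sq_abs (Real.sin A), ← sq_abs (Real.sin D)]
      field_simp
      ring
    nlinarith [sq_abs (Real.sin A), sq_abs (Real.sin D)]
  linarith

/-- The square root of the defect is subadditive. -/
theorem sqrt_defect_add_le (s t : ℝ) :
    √(defect μ (s + t)) ≤ √(defect μ s) + √(defect μ t) := by
  refine le_of_forall_pos_le_add fun e he => ?_
  have hs := defect_nonneg μ s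
  have ht := defect_nonneg μ t
  set a := √(defect μ s) with ha
  set b := √(defect μ t) with hb
  have ha0 : 0 ≤ a := Real.sqrt_nonneg _
  have hb0 : 0 ≤ b := Real.sqrt_nonneg _
  have hA : 0 < a + e / 2 := by positivity
  have hB : 0 < b + e / 2 := by positivity
  have h := defect_add_le μ s t (θ := (b + e / 2) / (a + e / 2)) (by positivity)
  rw [Real.sqrt_le_iff]
  refine ⟨by positivity, h.trans ?_⟩
  have h1 : defect μ s ≤ (a + e / 2) ^ 2 := by
    rw [← Real.sq_sqrt hs, ← ha]
    exact pow_le_pow_left₀ ha0 (by linarith) 2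
  have h2 : defect μ t ≤ (b + e / 2) ^ 2 := by
    rw [← Real.sq_sqrt ht, ← hb]
    exact pow_le_pow_left₀ hb0 (by linarith) 2
  calc _ ≤ (1 + (b + e / 2) / (a + e / 2)) * (a + e / 2) ^ 2
        + (1 + ((b + e / 2) / (a + e / 2))⁻¹) * (b + e / 2) ^ 2 := by gcongr
    _ = _ := by
      field_simp
      ring

/-- A characteristic function of modulus one at a nonzero point belongs to a lattice law. -/
theorem defect_pos_of_not_lattice (hμ : ¬ IsLatticeDistributed μ) {t : ℝ} (ht : t ≠ 0) :
    0 < defect μ t := by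
  refine lt_of_le_of_ne (defect_nonneg μ t) fun h0 => hμ ?_
  have h1 : (fun z : ℝ × ℝ => 2 * Real.sin (t * (z.1 - z.2) / 2) ^ 2) =ᵐ[μ.prod μ] 0 := by
    rw [defect_eq_integral, eq_comm, integral_eq_zero_iff_of_nonneg
      (fun z => by positivity) ((integrable_sin_sq μ t).const_mul _)] at h0
    exact h0
  have h2 := Measure.ae_ae_of_ae_prod h1
  -- Some point `a` of the line differs from almost every point by a multiple of `2π / t`.
  obtain ⟨a, ha⟩ := h2.exists
  refine ⟨a, 2 * Real.pi / |t|, by positivity, ?_⟩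
  filter_upwards [ha] with x hx
  have h3 : Real.sin (t * (a - x) / 2) = 0 := by simpa using hx
  obtain ⟨k, hk⟩ := Real.sin_eq_zero_iff.1 h3
  have h4 : t * (x - a) = -(2 * Real.pi * k) := by linarith
  rcases abs_cases t with h | h
  · refine ⟨-k, ?_⟩
    rw [h.1]
    push_cast
    field_simp
    linarith
  · refine ⟨k, ?_⟩
    rw [h.1]
    field_simp
    linarith

end Defect

/-! ### Power bounds from dyadic growth -/

/-- A subadditive function that contracts under halving is almost increasing: `t` is a sum of the
numbers `ξ / 2 ^ j`, over which the values of `g` form a geometric series. -/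
theorem le_mul_of_subadditive_of_halving {g : ℝ → ℝ} (hg0 : ∀ t, 0 ≤ g t)
    (hlim : Tendsto g (𝓝 0) (𝓝 0)) (hsub : ∀ s t, g (s + t) ≤ g s + g t) {r δ : ℝ} (hr0 : 0 ≤ r)
    (hr1 : r < 1) (hhalf : ∀ ξ, 0 < ξ → ξ ≤ δ → g (ξ / 2) ≤ r * g ξ) {t ξ : ℝ} (ht : 0 ≤ t)
    (htξ : t ≤ ξ) (hξ : ξ ≤ δ) : g t ≤ r / (1 - r) * g ξ := by
  have hr2 : 0 < 1 - r := by linarith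
  set C := r / (1 - r) with hC
  have hC0 : 0 ≤ C := by positivity
  have hCr : (1 + C) * r = C := by rw [hC]; field_simp; ring
  refine le_of_forall_pos_le_add fun e he => ?_
  obtain ⟨η, hη, hηg⟩ := Metric.eventually_nhds_iff.1 (hlim.eventually_lt_const he)
  have key : ∀ n : ℕ, ∀ ξ t : ℝ, 0 ≤ t → t ≤ ξ → ξ ≤ δ → ξ < 2 ^ n * η →
      g t ≤ C * g ξ + e := by
    have hsmall : ∀ ξ t : ℝ, 0 ≤ t → t < η → g t ≤ C * g ξ + e := by
      intro ξ t h0 h1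
      have h2 : g t < e := hηg (by rwa [Real.dist_0_eq_abs, abs_of_nonneg h0])
      have := mul_nonneg hC0 (hg0 ξ)
      linarith
    intro n
    induction n with
    | zero =>
      intro ξ t h0 h1 _ h3
      exact hsmall ξ t h0 (by linarith)
    | succ n ih =>
      intro ξ t h0 h1 h2 h3
      rcases (h0.trans h1).eq_or_lt with h4 | h4
      · exact hsmall ξ t h0 (by linarith)
      have h5 : ξ / 2 < 2 ^ n * η := by
        rw [pow_succ] at h3
        linarith
      have h6 := hhalf ξ h4 h2
      have h7 : (1 + C) * g (ξ / 2) ≤ C * g ξ := by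
        calc (1 + C) * g (ξ / 2) ≤ (1 + C) * (r * g ξ) := by gcongr
          _ = C * g ξ := by rw [← mul_assoc, hCr]
      have h8 := hg0 (ξ / 2)
      rcases le_total t (ξ / 2) with h9 | h9
      · have := ih (ξ / 2) t h0 h9 (by linarith) h5
        linarith
      · have h10 := ih (ξ / 2) (t - ξ / 2) (by linarith) (by linarith) (by linarith) h5
        have h11 := hsub (ξ / 2) (t - ξ / 2)
        rw [add_sub_cancel] at h11
        linarith
  obtain ⟨n, hn⟩ := pow_unbounded_of_one_lt (ξ / η) (one_lt_two (α := ℝ))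
  exact key n ξ t ht htξ hξ ((div_lt_iff₀ hη).1 hn)

/-- The power form of `le_mul_of_subadditive_of_halving`. -/
theorem le_rpow_mul_of_subadditive_of_halving {g : ℝ → ℝ} (hg0 : ∀ t, 0 ≤ g t)
    (hlim : Tendsto g (𝓝 0) (𝓝 0)) (hsub : ∀ s t, g (s + t) ≤ g s + g t) {γ δ : ℝ} (hγ : 0 < γ)
    (hhalf : ∀ ξ, 0 < ξ → ξ ≤ δ → g (ξ / 2) ≤ 2 ^ (-γ) * g ξ) :
    ∃ C : ℝ, 0 < C ∧ ∀ t ξ, 0 < t → t ≤ ξ → ξ ≤ δ → g t ≤ C * (t / ξ) ^ γ * g ξ := by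
  have hr0 : (0 : ℝ) < 2 ^ (-γ) := by positivity
  have hr1 : (2 : ℝ) ^ (-γ) < 1 := Real.rpow_lt_one_of_one_lt_of_neg one_lt_two (by linarith)
  set r : ℝ := 2 ^ (-γ) with hr
  have hC0 : 0 < r / (1 - r) := div_pos hr0 (by linarith)
  have hr2 : r * 2 ^ γ = 1 := by
    rw [hr, ← Real.rpow_add two_pos, neg_add_cancel, Real.rpow_zero]
  refine ⟨2 ^ γ * (r / (1 - r)), by positivity, ?_⟩
  have key : ∀ n : ℕ, ∀ t ξ, 0 < t → t ≤ ξ → ξ ≤ δ → ξ ≤ 2 ^ n * (2 * t) →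
      g t ≤ 2 ^ γ * (r / (1 - r)) * (t / ξ) ^ γ * g ξ := by
    have hbase : ∀ t ξ, 0 < t → t ≤ ξ → ξ ≤ δ → ξ ≤ 2 * t →
        g t ≤ 2 ^ γ * (r / (1 - r)) * (t / ξ) ^ γ * g ξ := by
      intro t ξ h0 h1 h2 h3
      have h4 : 0 < ξ := h0.trans_le h1
      have h5 := le_mul_of_subadditive_of_halving hg0 hlim hsub hr0.le hr1 hhalf h0.le h1 h2
      have h6 : 1 ≤ 2 ^ γ * (t / ξ) ^ γ := by
        rw [← Real.mul_rpow two_pos.le (by positivity)]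
        refine Real.one_le_rpow ?_ hγ.le
        rw [← mul_div_assoc, le_div_iff₀ h4]
        linarith
      calc g t ≤ r / (1 - r) * g ξ := h5
        _ ≤ (2 ^ γ * (t / ξ) ^ γ) * (r / (1 - r) * g ξ) :=
          le_mul_of_one_le_left (mul_nonneg hC0.le (hg0 ξ)) h6
        _ = _ := by ring
    intro n
    induction n with
    | zero =>
      intro t ξ h0 h1 h2 h3
      exact hbase t ξ h0 h1 h2 (by linarith)
    | succ n ih =>
      intro t ξ h0 h1 h2 h3
      rcases le_total ξ (2 * t) with h4 | h4
      · exact hbase t ξ h0 h1 h2 h4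
      have h5 : 0 < ξ := h0.trans_le h1
      have h6 : ξ / 2 ≤ 2 ^ n * (2 * t) := by
        rw [pow_succ] at h3
        linarith
      have h7 := ih t (ξ / 2) h0 (by linarith) (by linarith) h6
      have h8 : (t / (ξ / 2)) ^ γ = 2 ^ γ * (t / ξ) ^ γ := by
        rw [← Real.mul_rpow two_pos.le (by positivity)]
        congr 1
        field_simp
      calc g t ≤ 2 ^ γ * (r / (1 - r)) * (t / (ξ / 2)) ^ γ * g (ξ / 2) := h7
        _ ≤ 2 ^ γ * (r / (1 - r)) * (t / (ξ / 2)) ^ γ * (r * g ξ) := by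
          gcongr
          exact hhalf ξ h5 h2
        _ = 2 ^ γ * (r / (1 - r)) * (t / ξ) ^ γ * g ξ * (r * 2 ^ γ) := by
          rw [h8]
          ring
        _ = _ := by rw [hr2, mul_one]
  intro t ξ h0 h1 h2
  obtain ⟨n, hn⟩ := pow_unbounded_of_one_lt (ξ / (2 * t)) (one_lt_two (α := ℝ))
  exact key n t ξ h0 h1 h2 ((div_le_iff₀ (by positivity)).1 hn.le)

/-- Potter-type bound for the defect, on every bounded interval. Near the origin it comes from the
dyadic growth, and away from the origin the defect of a non-lattice law is bounded below. -/
theorem defect_le_rpow_mul_defect (μ : Measure ℝ) [IsProbabilityMeasure μ]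
    (hμ : ¬ IsLatticeDistributed μ) {κ : ℝ} (hκ : 0 < κ)
    (hgrow : ∀ᶠ t in 𝓝[>] (0 : ℝ), defect μ t ≤ 2 ^ (-κ) * defect μ (2 * t)) (R : ℝ) :
    ∃ δ C : ℝ, 0 < δ ∧ 0 < C ∧ ∀ τ t, 0 < τ → τ ≤ δ → τ ≤ |t| → |t| ≤ R →
      defect μ τ ≤ C * (τ / |t|) ^ κ * defect μ t := by
  obtain ⟨η, hη, hηg⟩ := mem_nhdsGT_iff_exists_Ioc_subset.1 hgrow
  have hη0 : (0 : ℝ) < η := hη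
  have h2 : ((2 : ℝ) ^ (-(κ / 2))) ^ 2 = 2 ^ (-κ) := by
    rw [← Real.rpow_natCast, ← Real.rpow_mul two_pos.le]
    congr 1
    push_cast
    ring
  obtain ⟨C₀, hC₀, hbound⟩ := le_rpow_mul_of_subadditive_of_halving (g := fun t => √(defect μ t))
    (γ := κ / 2) (δ := η) (fun t => Real.sqrt_nonneg _) (by
      have h : Tendsto (fun t => √(defect μ t)) (𝓝 0) (𝓝 (√(defect μ 0))) :=
        (Real.continuous_sqrt.comp (continuous_defect μ)).tendsto 0
      rwa [defect_zero, Real.sqrt_zero] at h) (sqrt_defect_add_le μ) (by positivity) (by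
      intro ξ h0 h1
      have h3 : defect μ (ξ / 2) ≤ 2 ^ (-κ) * defect μ (2 * (ξ / 2)) :=
        hηg ⟨by positivity, by linarith⟩
      rw [mul_div_cancel₀ _ two_ne_zero, ← h2] at h3
      refine (Real.sqrt_le_sqrt h3).trans_eq ?_
      rw [Real.sqrt_mul (sq_nonneg _), Real.sqrt_sq (by positivity)])
  have hnear : ∀ τ t, 0 < τ → τ ≤ t → t ≤ η → defect μ τ ≤ C₀ ^ 2 * (τ / t) ^ κ * defect μ t := by
    intro τ t h0 h1 h3
    have h4 := pow_le_pow_left₀ (Real.sqrt_nonneg _) (hbound τ t h0 h1 h3) 2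
    have h5 : 0 ≤ τ / t := div_nonneg h0.le (h0.le.trans h1)
    rw [Real.sq_sqrt (defect_nonneg μ _), mul_pow, mul_pow, Real.sq_sqrt (defect_nonneg μ _),
      ← Real.rpow_natCast ((τ / t) ^ (κ / 2)), ← Real.rpow_mul h5] at h4
    simpa using h4
  obtain ⟨m, hm, hmin⟩ : ∃ m : ℝ, 0 < m ∧ ∀ t ∈ Set.Icc η R, m ≤ defect μ t := by
    rcases (Set.Icc η R).eq_empty_or_nonempty with he | hne
    · exact ⟨1, one_pos, by simp [he]⟩
    · obtain ⟨x, hx, hxm⟩ := isCompact_Icc.exists_isMinOn hne (continuous_defect μ).continuousOn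
      exact ⟨defect μ x, defect_pos_of_not_lattice μ hμ (hη0.trans_le hx.1).ne', hxm⟩
  refine ⟨η, C₀ ^ 2 * (1 + (max R 0 / η) ^ κ / m), hη0, by positivity, ?_⟩
  intro τ t h0 h1 h3 h4
  have ht : 0 < |t| := h0.trans_le h3
  rw [← defect_abs μ t]
  have hR : 0 ≤ (max R 0 / η) ^ κ / m := by positivity
  rcases le_total |t| η with h5 | h5
  · refine (hnear τ |t| h0 h3 h5).trans ?_
    have := defect_nonneg μ |t|
    gcongr
    exact le_mul_of_one_le_right (sq_nonneg _) (by linarith)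
  · have h6 := hnear τ η h0 h1 le_rfl
    have h7 : defect μ η ≤ 1 := by
      rw [defect]
      linarith [sq_nonneg ‖charFun μ η‖]
    have h8 : m ≤ defect μ |t| := hmin _ ⟨h5, h4⟩
    have h9 : (τ / η) ^ κ ≤ (τ / |t|) ^ κ * (max R 0 / η) ^ κ := by
      rw [← Real.mul_rpow (by positivity) (by positivity)]
      refine Real.rpow_le_rpow (by positivity) ?_ hκ.le
      rw [div_mul_div_comm, div_le_div_iff₀ hη0 (by positivity)]
      have : |t| ≤ max R 0 := h4.trans (le_max_left _ _)
      have h10 : 0 ≤ τ * η := by positivity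
      nlinarith
    calc defect μ τ ≤ C₀ ^ 2 * (τ / η) ^ κ * defect μ η := h6
      _ ≤ C₀ ^ 2 * ((τ / |t|) ^ κ * (max R 0 / η) ^ κ) * 1 := by
        have := defect_nonneg μ η
        gcongr
      _ ≤ C₀ ^ 2 * ((τ / |t|) ^ κ * (max R 0 / η) ^ κ) * (defect μ |t| / m) := by
        gcongr
        rwa [one_le_div hm]
      _ = C₀ ^ 2 * ((max R 0 / η) ^ κ / m) * (τ / |t|) ^ κ * defect μ |t| := by ring
      _ ≤ _ := by
        have := defect_nonneg μ |t|
        gcongr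
        linarith

/-! ### The stable exponent -/

/-- The skewness coefficient `β tan (π α / 2)`; outside the excluded case it is the constant value
of `β h(α, ξ)`. -/
noncomputable def skew (α β : ℝ) : ℝ := if α = 1 then 0 else β * Real.tan (Real.pi * α / 2)

theorem mul_stableH {α β : ℝ} (hαβ : ¬ (α = 1 ∧ β ≠ 0)) (ξ : ℝ) :
    β * stableH α ξ = skew α β := by
  rw [stableH, skew]
  split_ifs with h
  · have : β = 0 := by
      by_contra h0
      exact hαβ ⟨h, h0⟩
    rw [this, zero_mul]
  · rfl

theorem stableSymbol_eq {α β : ℝ} (hαβ : ¬ (α = 1 ∧ β ≠ 0)) (c ξ : ℝ) :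
    stableSymbol c α β ξ
      = ((|c * ξ| ^ α : ℝ) : ℂ) * (1 - Complex.I * ((skew α β * Real.sign ξ : ℝ) : ℂ)) := by
  rw [stableSymbol, ← mul_stableH hαβ ξ]
  push_cast
  ring

theorem norm_cexp_stableExponent {α β : ℝ} (hαβ : ¬ (α = 1 ∧ β ≠ 0)) (c ξ : ℝ) :
    ‖Complex.exp (stableExponent c α β ξ)‖ = Real.exp (-(|c * ξ| ^ α)) := by
  rw [Complex.norm_exp, stableExponent, stableSymbol_eq hαβ, Complex.neg_re, Complex.re_ofReal_mul]
  simp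

/-- Homogeneity of the symbol: this is where the case `α = 1`, `β ≠ 0` has to be excluded. -/
theorem stableSymbol_mul {α β : ℝ} (hαβ : ¬ (α = 1 ∧ β ≠ 0)) (c ξ : ℝ) {b : ℝ} (hb : 0 < b) :
    stableSymbol c α β (ξ * b) = ((b ^ α : ℝ) : ℂ) * stableSymbol c α β ξ := by
  have hsign : Real.sign (ξ * b) = Real.sign ξ := by
    rcases lt_trichotomy ξ 0 with h | h | h
    · rw [Real.sign_of_neg h, Real.sign_of_neg (mul_neg_of_neg_of_pos h hb)]
    · rw [h, zero_mul]
    · rw [Real.sign_of_pos h, Real.sign_of_pos (mul_pos h hb)]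
  rw [stableSymbol_eq hαβ, stableSymbol_eq hαβ, hsign, ← mul_assoc c, abs_mul (c * ξ), abs_of_pos hb,
    Real.mul_rpow (abs_nonneg _) hb.le]
  push_cast
  ring

theorem integrable_exp_neg_mul_abs_rpow {k p : ℝ} (hk : 0 < k) (hp : 0 < p) :
    Integrable fun ξ : ℝ => Real.exp (-(k * |ξ| ^ p)) := by
  have h : IntegrableOn (fun ξ : ℝ => Real.exp (-(k * |ξ| ^ p))) (Set.Ioi 0) := by
    refine (integrableOn_rpow_mul_exp_neg_mul_rpow (s := 0) (by norm_num) hp hk).congr_fun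
      (fun x hx => ?_) measurableSet_Ioi
    simp only [Real.rpow_zero, one_mul, abs_of_pos (Set.mem_Ioi.1 hx), neg_mul]
  rw [← integrableOn_univ, ← Set.Iic_union_Ioi (a := (0 : ℝ))]
  refine IntegrableOn.union ?_ h
  rw [integrableOn_Iic_iff_integrableOn_Iio]
  have h2 := h.comp_neg
  simpa using h2

theorem integrable_charFun_of_isStableLaw {c α β : ℝ} (hc : 0 < c) (hα : 0 < α)
    (hαβ : ¬ (α = 1 ∧ β ≠ 0)) {φ : Measure ℝ} [IsProbabilityMeasure φ]
    (hφ : IsStableLaw φ c α β) : Integrable (charFun φ) := by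
  refine (integrable_exp_neg_mul_abs_rpow (Real.rpow_pos_of_pos hc α) hα).mono'
    stronglyMeasurable_charFun.aestronglyMeasurable (ae_of_all _ fun ξ => ?_)
  rw [hφ.charFun_eq, norm_cexp_stableExponent hαβ, abs_mul, abs_of_pos hc,
    Real.mul_rpow hc.le (abs_nonneg _)]

theorem stableDensity_eq {c α β : ℝ} {φ : Measure ℝ} (hφ : IsStableLaw φ c α β) (x : ℝ) :
    stableDensity c α β x = 1 / (2 * Real.pi) * (inversionIntegral (charFun φ) x).re := by
  rw [stableDensity, inversionIntegral]
  congr 3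
  funext ξ
  rw [hφ.charFun_eq, ← Complex.exp_add]
  congr 1
  ring

/-! ### Asymptotics of the characteristic function near the origin -/

theorem tendsto_one_sub_exp_neg_div :
    Tendsto (fun x : ℝ => (1 - Real.exp (-(2 * x))) / x) (𝓝[≠] 0) (𝓝 2) := by
  have h : HasDerivAt (fun x : ℝ => 1 - Real.exp (-(2 * x))) 2 0 := by
    have h1 : HasDerivAt (fun x : ℝ => -(2 * x)) (-2) 0 := by
      simpa [neg_mul] using (hasDerivAt_id (0 : ℝ)).const_mul (-2)
    simpa using h1.exp.const_sub 1
  have h2 := hasDerivAt_iff_tendsto_slope_zero.1 h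
  refine h2.congr fun x => ?_
  simp [div_eq_inv_mul]

section NearZero

variable {c α β : ℝ} {μ : Measure ℝ} {m : ℝ} {s : ℝ → ℝ} {ε : ℝ → ℂ}

/-- The defect is asymptotic to `2 |c ξ|^α s(ξ)`. This replaces `s`, on which no measurability is
assumed, by a function built from the continuous subadditive function `√(defect μ)`. -/
theorem tendsto_defect_div [IsProbabilityMeasure μ] (hc : 0 < c) (hαβ : ¬ (α = 1 ∧ β ≠ 0))
    (hs : IsSlowlyVaryingAtZero s) (hε : Tendsto ε (𝓝[≠] 0) (𝓝 0))
    (hFourier : ∀ᶠ ξ : ℝ in 𝓝 0, charFun μ ξ = Complex.exp (Complex.I * (m : ℂ) * (ξ : ℂ)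
      - stableSymbol c α β ξ * (s ξ : ℂ) * (1 + ε ξ))) :
    Tendsto (fun ξ => defect μ ξ / (|ξ| ^ α * s ξ)) (𝓝[≠] 0) (𝓝 (2 * c ^ α)) := by
  set q : ℝ → ℝ := fun ξ => 1 + (ε ξ).re + skew α β * Real.sign ξ * (ε ξ).im with hq
  have hnorm : ∀ᶠ ξ in 𝓝 (0 : ℝ), ‖charFun μ ξ‖ = Real.exp (-(|c * ξ| ^ α * s ξ * q ξ)) := by
    filter_upwards [hFourier] with ξ hξ
    rw [hξ, Complex.norm_exp, stableSymbol_eq hαβ, hq]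
    congr 1
    simp
    ring
  have hq1 : Tendsto q (𝓝[≠] 0) (𝓝 1) := by
    have hre : Tendsto (fun ξ => (ε ξ).re) (𝓝[≠] 0) (𝓝 0) := by
      simpa [Function.comp_def] using (Complex.continuous_re.tendsto _).comp hε
    have him : Tendsto (fun ξ => (ε ξ).im) (𝓝[≠] 0) (𝓝 0) := by
      simpa [Function.comp_def] using (Complex.continuous_im.tendsto _).comp hε
    have hb : Tendsto (fun ξ => skew α β * Real.sign ξ * (ε ξ).im) (𝓝[≠] 0) (𝓝 0) := by
      refine bdd_le_mul_tendsto_zero' |skew α β| (Eventually.of_forall fun ξ => ?_) him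
      rw [abs_mul]
      refine mul_le_of_le_one_right (abs_nonneg _) ?_
      rcases Real.sign_apply_eq ξ with h | h | h <;> simp [h]
    simpa using (hre.const_add 1).add hb
  set ψ : ℝ → ℝ := fun ξ => |c * ξ| ^ α * s ξ * q ξ with hψ
  have hψ0 : Tendsto ψ (𝓝[≠] 0) (𝓝 0) := by
    have h1 : Tendsto (fun ξ => -Real.log ‖charFun μ ξ‖) (𝓝 0) (𝓝 0) := by
      have hcont : Continuous fun ξ => ‖charFun μ ξ‖ := (continuous_charFun (μ := μ)).norm
      have h2 : Tendsto (fun ξ => ‖charFun μ ξ‖) (𝓝 0) (𝓝 1) := by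
        simpa using hcont.tendsto 0
      simpa using (h2.log one_ne_zero).neg
    refine (h1.congr' ?_).mono_left nhdsWithin_le_nhds
    filter_upwards [hnorm] with ξ hξ
    rw [hξ, Real.log_exp, neg_neg]
  have hqpos : ∀ᶠ ξ in 𝓝[≠] (0 : ℝ), 0 < q ξ := hq1.eventually_const_lt one_pos
  have hψne : Tendsto ψ (𝓝[≠] 0) (𝓝[≠] 0) := by
    refine tendsto_nhdsWithin_iff.2 ⟨hψ0, ?_⟩
    filter_upwards [hs.pos, hqpos, self_mem_nhdsWithin] with ξ h1 h2 h3
    have h4 : 0 < |c * ξ| := abs_pos.2 (mul_ne_zero hc.ne' h3)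
    have : 0 < ψ ξ := by positivity
    exact this.ne'
  have hlim := ((tendsto_one_sub_exp_neg_div.comp hψne).mul hq1).mul_const (c ^ α)
  rw [mul_one] at hlim
  refine hlim.congr' ?_
  filter_upwards [hs.pos, hqpos, self_mem_nhdsWithin, nhdsWithin_le_nhds hnorm] with ξ h1 h2 h3 h4
  have h5 : 0 < |ξ| := abs_pos.2 h3
  have h6 : 0 < |ξ| ^ α := Real.rpow_pos_of_pos h5 α
  have h7 : 0 < c ^ α := Real.rpow_pos_of_pos hc α
  have h8 : ψ ξ = c ^ α * |ξ| ^ α * s ξ * q ξ := by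
    rw [hψ]
    simp only
    rw [abs_mul, abs_of_pos hc, Real.mul_rpow hc.le (abs_nonneg _)]
  have h9 : defect μ ξ = 1 - Real.exp (-(2 * ψ ξ)) := by
    rw [defect, h4, ← Real.exp_nat_mul]
    congr 2
    push_cast
    ring
  simp only [Function.comp_apply]
  rw [← h9, h8]
  field_simp

/-- Dyadic growth of the defect, at any exponent below `α`. -/
theorem eventually_defect_le [IsProbabilityMeasure μ] (hc : 0 < c) (hαβ : ¬ (α = 1 ∧ β ≠ 0))
    (hs : IsSlowlyVaryingAtZero s) (hε : Tendsto ε (𝓝[≠] 0) (𝓝 0))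
    (hFourier : ∀ᶠ ξ : ℝ in 𝓝 0, charFun μ ξ = Complex.exp (Complex.I * (m : ℂ) * (ξ : ℂ)
      - stableSymbol c α β ξ * (s ξ : ℂ) * (1 + ε ξ))) {κ : ℝ} (hκ : κ < α) :
    ∀ᶠ t in 𝓝[>] (0 : ℝ), defect μ t ≤ 2 ^ (-κ) * defect μ (2 * t) := by
  have hD := tendsto_defect_div hc hαβ hs hε hFourier
  have hcα : 0 < 2 * c ^ α := by positivity
  have h2 : Tendsto (fun ξ : ℝ => 2 * ξ) (𝓝[≠] 0) (𝓝[≠] 0) := by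
    refine tendsto_nhdsWithin_iff.2 ⟨?_, ?_⟩
    · have : Tendsto (fun ξ : ℝ => 2 * ξ) (𝓝 0) (𝓝 (2 * 0)) := (continuous_const_mul 2).tendsto 0
      rw [mul_zero] at this
      exact this.mono_left nhdsWithin_le_nhds
    · filter_upwards [self_mem_nhdsWithin] with ξ hξ
      exact mul_ne_zero two_ne_zero hξ
  have hratio := ((hD.comp h2).div hD hcα.ne').mul ((hs.tendsto 2 two_ne_zero).const_mul (2 ^ α))
  rw [div_self hcα.ne', one_mul, mul_one] at hratio
  have hlt : (2 : ℝ) ^ κ < 2 ^ α := Real.rpow_lt_rpow_of_exponent_lt one_lt_two hκ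
  have hev := hratio.eventually_const_lt hlt
  have hpos := hD.eventually_const_lt hcα
  have hfinal : ∀ᶠ t in 𝓝[≠] (0 : ℝ), defect μ t ≤ 2 ^ (-κ) * defect μ (2 * t) := by
    filter_upwards [hev, hpos, hs.pos, h2.eventually hs.pos, self_mem_nhdsWithin]
      with t h3 h4 h5 h6 h7
    have ht : 0 < |t| := abs_pos.2 h7
    have htα : 0 < |t| ^ α := Real.rpow_pos_of_pos ht α
    have hdef : 0 < defect μ t := by
      have := mul_pos h4 (mul_pos htα h5)
      rwa [div_mul_cancel₀ _ (mul_pos htα h5).ne'] at this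
    have h8 : defect μ (2 * t) / (|2 * t| ^ α * s (2 * t)) / (defect μ t / (|t| ^ α * s t)) *
        (2 ^ α * (s (2 * t) / s t)) = defect μ (2 * t) / defect μ t := by
      rw [abs_mul, abs_two, Real.mul_rpow two_pos.le (abs_nonneg _)]
      field_simp
    have h9 : (2 : ℝ) ^ κ < defect μ (2 * t) / defect μ t := by
      rw [← h8]
      exact h3
    rw [lt_div_iff₀ hdef] at h9
    rw [Real.rpow_neg two_pos.le, ← div_eq_inv_mul, le_div_iff₀ (by positivity), mul_comm]
    exact h9.le
  exact hfinal.filter_mono (nhdsWithin_mono _ fun x hx => ne_of_gt hx)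

section Scaling

variable {B : ℕ → ℝ}

theorem tendsto_mul_inv_nhdsNE (hBtop : Tendsto B atTop atTop) {ξ : ℝ} (hξ : ξ ≠ 0) :
    Tendsto (fun n => ξ * (1 / B n)) atTop (𝓝[≠] 0) := by
  refine tendsto_nhdsWithin_iff.2 ⟨?_, ?_⟩
  · simpa using (tendsto_inv_atTop_zero.comp hBtop).const_mul ξ
  · filter_upwards [hBtop.eventually_gt_atTop 0] with n hn
    exact mul_ne_zero hξ (by positivity)

/-- The scaling constants are such that the defect at `1 / B n` is of exact order `1 / n`. -/
theorem tendsto_mul_defect [IsProbabilityMeasure μ] (hc : 0 < c) (hαβ : ¬ (α = 1 ∧ β ≠ 0))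
    (hs : IsSlowlyVaryingAtZero s) (hε : Tendsto ε (𝓝[≠] 0) (𝓝 0))
    (hFourier : ∀ᶠ ξ : ℝ in 𝓝 0, charFun μ ξ = Complex.exp (Complex.I * (m : ℂ) * (ξ : ℂ)
      - stableSymbol c α β ξ * (s ξ : ℂ) * (1 + ε ξ)))
    (hB : ∀ᶠ n : ℕ in atTop, B n ^ α = (n : ℝ) * s (1 / B n)) (hBtop : Tendsto B atTop atTop) :
    Tendsto (fun n : ℕ => (n : ℝ) * defect μ (1 / B n)) atTop (𝓝 (2 * c ^ α)) := by
  have h1 := tendsto_mul_inv_nhdsNE hBtop one_ne_zero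
  simp only [one_mul] at h1
  refine ((tendsto_defect_div hc hαβ hs hε hFourier).comp h1).congr' ?_
  filter_upwards [hB, hBtop.eventually_gt_atTop 0, h1.eventually hs.pos] with n h2 h3 h4
  simp only [Function.comp_apply]
  have h5 : 0 < B n ^ α := Real.rpow_pos_of_pos h3 α
  rw [abs_of_pos (by positivity), Real.div_rpow zero_le_one h3.le, Real.one_rpow]
  have h6 : (n : ℝ) = B n ^ α / s (1 / B n) := by
    rw [h2]
    field_simp
  rw [h6]
  field_simp

/-- Convergence of the characteristic functions of the normalized sums. -/
theorem tendsto_charFun_pow (hαβ : ¬ (α = 1 ∧ β ≠ 0))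
    (hs : IsSlowlyVaryingAtZero s) (hε : Tendsto ε (𝓝[≠] 0) (𝓝 0))
    (hFourier : ∀ᶠ ξ : ℝ in 𝓝 0, charFun μ ξ = Complex.exp (Complex.I * (m : ℂ) * (ξ : ℂ)
      - stableSymbol c α β ξ * (s ξ : ℂ) * (1 + ε ξ)))
    (hB : ∀ᶠ n : ℕ in atTop, B n ^ α = (n : ℝ) * s (1 / B n)) (hBtop : Tendsto B atTop atTop)
    {ξ : ℝ} (hξ : ξ ≠ 0) :
    Tendsto (fun n : ℕ => charFun μ (ξ * (1 / B n)) ^ n *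
      Complex.exp (-(((ξ * (1 / B n)) * (n * m) : ℝ) * Complex.I))) atTop
      (𝓝 (Complex.exp (stableExponent c α β ξ))) := by
  have h1 := tendsto_mul_inv_nhdsNE hBtop one_ne_zero
  simp only [one_mul] at h1
  have hξt := tendsto_mul_inv_nhdsNE hBtop hξ
  have h2 : Tendsto (fun n : ℕ => ((s (ξ * (1 / B n)) / s (1 / B n) : ℝ) : ℂ)) atTop (𝓝 1) := by
    have := (Complex.continuous_ofReal.tendsto _).comp ((hs.tendsto ξ hξ).comp h1)
    simpa [Function.comp_def] using this
  have h3 : Tendsto (fun n : ℕ => 1 + ε (ξ * (1 / B n))) atTop (𝓝 1) := by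
    simpa using (hε.comp hξt).const_add 1
  have h4 := ((h2.mul h3).const_mul (-stableSymbol c α β ξ))
  rw [one_mul, mul_one] at h4
  refine ((Complex.continuous_exp.tendsto _).comp h4).congr' ?_
  filter_upwards [hB, hBtop.eventually_gt_atTop 0, h1.eventually hs.pos,
    (hξt.mono_right nhdsWithin_le_nhds).eventually hFourier] with n h5 h6 h7 h8
  simp only [Function.comp_apply]
  rw [h8, ← Complex.exp_nat_mul, ← Complex.exp_add, stableSymbol_mul hαβ c ξ (by positivity)]
  congr 1
  have h9 : (n : ℝ) * (1 / B n) ^ α = 1 / s (1 / B n) := by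
    have : 0 < B n ^ α := Real.rpow_pos_of_pos h6 α
    rw [Real.div_rpow zero_le_one h6.le, Real.one_rpow, mul_one_div, div_eq_div_iff this.ne' h7.ne',
      one_mul, h5]
  have h10 : (n : ℂ) * (((1 / B n) ^ α : ℝ) : ℂ) = ((1 / s (1 / B n) : ℝ) : ℂ) := by
    rw [← h9]
    push_cast
    rfl
  have h11 : ((s (ξ * (1 / B n)) / s (1 / B n) : ℝ) : ℂ)
      = ((1 / s (1 / B n) : ℝ) : ℂ) * (s (ξ * (1 / B n)) : ℂ) := by
    rw [← Complex.ofReal_mul]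
    congr 1
    ring
  rw [h11, ← h10]
  push_cast
  ring

end Scaling

end NearZero

/-! ### The local limit theorem -/

/-- Parseval's relation for the Fejér weight. -/
theorem integral_fejer_mul_exp_eq {a : ℝ} (ha : 0 < a) (ν : Measure ℝ) [IsFiniteMeasure ν] (u : ℝ) :
    ∫ y, (fejer a y : ℂ) * Complex.exp (u * y * Complex.I) ∂ν
      = ∫ t : ℝ, (tri a (t - u) : ℂ) * charFun ν t := by
  have hm : Measurable fun t => ENNReal.ofReal (tri a t) := (continuous_tri a).measurable.ennreal_ofReal
  have hfin : IsFiniteMeasure (volume.withDensity fun t => ENNReal.ofReal (tri a t)) :=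
    isFiniteMeasure_withDensity_ofReal (integrable_tri a).2
  have hint : ∀ f : ℝ → ℂ, ∫ t, f t ∂(volume.withDensity fun t => ENNReal.ofReal (tri a t))
      = ∫ t, (tri a t : ℂ) * f t := by
    intro f
    rw [integral_withDensity_eq_integral_toReal_smul hm (ae_of_all _ fun _ => ENNReal.ofReal_lt_top)]
    refine integral_congr_ae (ae_of_all _ fun t => ?_)
    simp [ENNReal.toReal_ofReal (tri_nonneg a t)]
  have hchar : ∀ y, charFun (volume.withDensity fun t => ENNReal.ofReal (tri a t)) y = fejer a y := by
    intro y
    rw [charFun_apply_real, hint, integral_tri_mul_exp ha]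
  have h := integral_charFun_mul_exp (volume.withDensity fun t => ENNReal.ofReal (tri a t)) ν u
  simp_rw [hchar] at h
  rw [h, hint, ← integral_add_right_eq_self (fun t : ℝ => (tri a (t - u) : ℂ) * charFun ν t) u]
  simp only [add_sub_cancel_right]

theorem norm_charFun_pow_le (μ : Measure ℝ) (t : ℝ) (n : ℕ) :
    ‖charFun μ t‖ ^ n ≤ Real.exp (-(n * defect μ t / 2)) := by
  have h1 : ‖charFun μ t‖ ^ 2 ≤ Real.exp (-defect μ t) := by
    have := Real.add_one_le_exp (-defect μ t)
    rw [defect] at this ⊢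
    linarith
  have h2 : ‖charFun μ t‖ ≤ Real.exp (-(defect μ t / 2)) := by
    refine le_of_sq_le_sq ?_ (Real.exp_pos _).le
    rwa [← Real.exp_nat_mul,
      show ((2 : ℕ) : ℝ) * -(defect μ t / 2) = -defect μ t by push_cast; ring]
  refine (pow_le_pow_left₀ (norm_nonneg _) h2 n).trans_eq ?_
  rw [← Real.exp_nat_mul]
  congr 1
  ring

/-- The Fourier side of the local limit theorem. The integrand converges pointwise, and the
bound on the defect gives the integrable majorant `exp (-k |ξ| ^ (α / 2))` on the whole
support of the triangular cut-off, whose width is of order `B n`. -/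
theorem tendsto_integral_tri_mul_charFun_pow
    {c α β : ℝ} (hc : 0 < c) (hα : 0 < α) (hαβ : ¬ (α = 1 ∧ β ≠ 0))
    {φ : Measure ℝ} [IsProbabilityMeasure φ] (hφ : IsStableLaw φ c α β)
    {μ : Measure ℝ} [IsProbabilityMeasure μ] (hlattice : ¬ IsLatticeDistributed μ)
    {m : ℝ} {s : ℝ → ℝ} {ε : ℝ → ℂ}
    (hs : IsSlowlyVaryingAtZero s) (hε : Tendsto ε (𝓝[≠] 0) (𝓝 0))
    (hFourier : ∀ᶠ ξ : ℝ in 𝓝 0, charFun μ ξ = Complex.exp (Complex.I * (m : ℂ) * (ξ : ℂ)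
      - stableSymbol c α β ξ * (s ξ : ℂ) * (1 + ε ξ)))
    {B : ℕ → ℝ} (hB : ∀ᶠ n : ℕ in atTop, B n ^ α = (n : ℝ) * s (1 / B n))
    (hBtop : Tendsto B atTop atTop) {a : ℝ} (ha : 0 < a) (u x : ℝ) :
    Tendsto (fun n : ℕ => ∫ ξ : ℝ, (tri a (ξ * (1 / B n) - u) : ℂ) *
        (charFun μ (ξ * (1 / B n)) ^ n *
          Complex.exp (-(((ξ * (1 / B n)) * (n * m + B n * x) : ℝ) * Complex.I))))
      atTop (𝓝 ((tri a u : ℂ) * inversionIntegral (charFun φ) x)) := by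
  obtain ⟨δ, C, hδ, hC, hpotter⟩ := defect_le_rpow_mul_defect μ hlattice (half_pos hα)
    (eventually_defect_le hc hαβ hs hε hFourier (half_lt_self hα)) (|u| + a)
  have hcα : 0 < c ^ α := Real.rpow_pos_of_pos hc α
  set k : ℝ := c ^ α / (2 * C) with hk
  have hk0 : 0 < k := by positivity
  have h1 := tendsto_mul_inv_nhdsNE hBtop one_ne_zero
  simp only [one_mul] at h1
  rw [inversionIntegral, ← integral_const_mul]
  refine tendsto_integral_filter_of_dominated_convergence
    (fun ξ => a * (Real.exp k * Real.exp (-(k * |ξ| ^ (α / 2))))) ?_ ?_ ?_ ?_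
  · refine Eventually.of_forall fun n => Continuous.aestronglyMeasurable ?_
    have h2 : Continuous (charFun μ) := continuous_charFun
    have h3 := continuous_tri a
    fun_prop
  · have hdef := (tendsto_mul_defect hc hαβ hs hε hFourier hB hBtop).eventually_const_lt
      (show c ^ α < 2 * c ^ α by linarith)
    have hsmall : ∀ᶠ n in atTop, 1 / B n ≤ δ :=
      ((tendsto_nhdsWithin_iff.1 h1).1.eventually_lt_const hδ).mono fun n hn => hn.le
    filter_upwards [hdef, hsmall, hBtop.eventually_gt_atTop 0] with n h2 h3 h4
    refine ae_of_all _ fun ξ => ?_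
    have hτ : 0 < 1 / B n := by positivity
    set t := ξ * (1 / B n) with ht
    rw [norm_mul, norm_mul, norm_pow, ← neg_mul, ← Complex.ofReal_neg, Complex.norm_exp_ofReal_mul_I,
      mul_one, Complex.norm_real, Real.norm_of_nonneg (tri_nonneg _ _)]
    rcases le_or_gt a |t - u| with h5 | h5
    · rw [tri_eq_zero h5, zero_mul]
      positivity
    refine mul_le_mul (tri_le ha.le _) ?_ (by positivity) ha.le
    rw [← Real.exp_add]
    rcases le_total |ξ| 1 with h6 | h6
    · refine (pow_le_one₀ (norm_nonneg _) (norm_charFun_le_one _)).trans (Real.one_le_exp ?_)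
      have := Real.rpow_le_one (abs_nonneg ξ) h6 (half_pos hα).le
      nlinarith
    · have habs : |t| = |ξ| * (1 / B n) := by rw [ht, abs_mul, abs_of_pos hτ]
      have h7 : 1 / B n ≤ |t| := by
        rw [habs]
        exact le_mul_of_one_le_left hτ.le h6
      have h8 : |t| ≤ |u| + a := by
        have := abs_add_le (t - u) u
        rw [sub_add_cancel] at this
        linarith
      have h9 := hpotter (1 / B n) t hτ h3 h7 h8
      have h10 : 1 / B n / |t| = |ξ|⁻¹ := by
        rw [habs]
        field_simp
      have hξ0 : 0 < |ξ| := one_pos.trans_le h6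
      have hξα : 0 < |ξ| ^ (α / 2) := Real.rpow_pos_of_pos hξ0 _
      rw [h10, Real.inv_rpow hξ0.le] at h9
      refine (norm_charFun_pow_le μ t n).trans (Real.exp_le_exp.2 ?_)
      have h11 : c ^ α * |ξ| ^ (α / 2) ≤ C * (n * defect μ t) := by
        calc c ^ α * |ξ| ^ (α / 2) ≤ (n * defect μ (1 / B n)) * |ξ| ^ (α / 2) := by gcongr
          _ ≤ (n * (C * (|ξ| ^ (α / 2))⁻¹ * defect μ t)) * |ξ| ^ (α / 2) := by gcongr
          _ = C * (n * defect μ t) := by field_simp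
      have h12 : k * |ξ| ^ (α / 2) ≤ n * defect μ t / 2 := by
        rw [hk, div_mul_eq_mul_div, div_le_iff₀ (by positivity)]
        linarith
      linarith
  · exact ((integrable_exp_neg_mul_abs_rpow hk0 (half_pos hα)).const_mul _).const_mul _
  · filter_upwards [compl_mem_ae_iff.2 (measure_singleton (0 : ℝ))] with ξ hξ
    have hξ0 : ξ ≠ 0 := hξ
    have h2 : Tendsto (fun n => (tri a (ξ * (1 / B n) - u) : ℂ)) atTop (𝓝 (tri a u : ℂ)) := by
      have h3 := (tendsto_nhdsWithin_iff.1 (tendsto_mul_inv_nhdsNE hBtop hξ0)).1.sub_const u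
      rw [zero_sub] at h3
      have h4 := ((continuous_tri a).tendsto _).comp h3
      rw [tri_neg] at h4
      exact (Complex.continuous_ofReal.tendsto _).comp h4
    have h3 := (tendsto_charFun_pow hαβ hs hε hFourier hB hBtop hξ0).mul_const
      (Complex.exp (-(ξ * x * Complex.I)))
    rw [← hφ.charFun_eq] at h3
    refine (h2.mul h3).congr' ?_
    filter_upwards [hBtop.eventually_gt_atTop 0] with n hn
    rw [mul_assoc (charFun μ _ ^ n), ← Complex.exp_add]
    congr 3
    have : (B n : ℂ) ≠ 0 := Complex.ofReal_ne_zero.2 hn.ne'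
    push_cast
    field_simp
    ring

/-- The characteristic function of a centred sum of independent copies. -/
theorem charFun_map_sum_add_const {Ω : Type*} [MeasurableSpace Ω] {P : Measure Ω}
    [IsProbabilityMeasure P] {μ : Measure ℝ} {X : ℕ → Ω → ℝ} (hX : ∀ i, HasLaw (X i) μ P)
    (hindep : iIndepFun X P) (n : ℕ) (b t : ℝ) :
    charFun (P.map fun ω => ∑ i ∈ Finset.range n, X i ω + b) t
      = charFun μ t ^ n * Complex.exp ((t * b : ℝ) * Complex.I) := by
  have hm : AEMeasurable (fun ω => ∑ i ∈ Finset.range n, X i ω) P :=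
    Finset.aemeasurable_fun_sum _ fun i _ => (hX i).aemeasurable
  have h1 : P.map (fun ω => ∑ i ∈ Finset.range n, X i ω + b)
      = (P.map fun ω => ∑ i ∈ Finset.range n, X i ω).map (· + b) := by
    rw [AEMeasurable.map_map_of_aemeasurable (by fun_prop) hm]
    rfl
  have h2 := iIndepFun.charFun_map_fun_finsetSum_eq_prod (s := Finset.range n)
    (fun i _ => (hX i).aemeasurable) (hindep.restrict _)
  rw [h1, charFun_map_add_const, h2, Finset.prod_apply]
  simp [(hX _).map_eq]

/-- The local limit theorem, on bounded sets with null frontier. -/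
theorem tendsto_mul_measureReal_sum_mem
    {c α β : ℝ} (hc : 0 < c) (hα : 0 < α) (hαβ : ¬ (α = 1 ∧ β ≠ 0))
    {φ : Measure ℝ} [IsProbabilityMeasure φ] (hφ : IsStableLaw φ c α β)
    {μ : Measure ℝ} [IsProbabilityMeasure μ] (hlattice : ¬ IsLatticeDistributed μ)
    {m : ℝ} {s : ℝ → ℝ} {ε : ℝ → ℂ}
    (hs : IsSlowlyVaryingAtZero s) (hε : Tendsto ε (𝓝[≠] 0) (𝓝 0))
    (hFourier : ∀ᶠ ξ : ℝ in 𝓝 0, charFun μ ξ = Complex.exp (Complex.I * (m : ℂ) * (ξ : ℂ)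
      - stableSymbol c α β ξ * (s ξ : ℂ) * (1 + ε ξ)))
    {B : ℕ → ℝ} (hB : ∀ᶠ n : ℕ in atTop, B n ^ α = (n : ℝ) * s (1 / B n))
    (hBtop : Tendsto B atTop atTop)
    {Ω : Type*} [MeasurableSpace Ω] {P : Measure Ω} [IsProbabilityMeasure P]
    {X : ℕ → Ω → ℝ} (hX : ∀ i, HasLaw (X i) μ P) (hindep : iIndepFun X P)
    (x : ℝ) {C : Set ℝ} (hC : IsJordanMeasurable C) :
    Tendsto (fun n : ℕ => B n * P.real {ω | ∑ i ∈ Finset.range n, X i ω ∈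
        (fun y : ℝ => (n : ℝ) * m + B n * x + y) '' C})
      atTop (𝓝 (stableDensity c α β x * volume.real C)) := by
  obtain ⟨r, hr0, hCr⟩ := hC.isBounded.subset_closedBall_lt 0 0
  set a : ℝ := 1 / r with ha
  have ha0 : 0 < a := by positivity
  -- On `[-r, r]` the weight `fejer (1 / r)` has no zero.
  obtain ⟨k, hk, hKk⟩ : ∃ k : ℝ, 0 < k ∧ ∀ y ∈ Metric.closedBall (0 : ℝ) r, k ≤ fejer a y := by
    obtain ⟨y₀, hy₀, hmin⟩ := (isCompact_closedBall (0 : ℝ) r).exists_isMinOn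
      (Metric.nonempty_closedBall.2 hr0.le) (continuous_fejer a).continuousOn
    refine ⟨fejer a y₀, fejer_pos ha0 ?_, hmin⟩
    have h1 : |y₀| ≤ r := by simpa using hy₀
    have h2 : a * |y₀| ≤ 1 := by
      rw [ha, div_mul_eq_mul_div, one_mul]
      exact div_le_one_of_le₀ h1 hr0.le
    linarith [Real.pi_gt_three]
  set T : ℕ → Ω → ℝ := fun n ω => ∑ i ∈ Finset.range n, X i ω + -((n : ℝ) * m + B n * x) with hT
  have hTm : ∀ n, AEMeasurable (T n) P := fun n =>
    (Finset.aemeasurable_fun_sum _ fun i _ => (hX i).aemeasurable).add_const _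
  have hTprob : ∀ n, IsProbabilityMeasure (P.map (T n)) := fun n =>
    Measure.isProbabilityMeasure_map (hTm n)
  set p := stableDensity c α β x with hp
  have hφint := integrable_charFun_of_isStableLaw hc hα hαβ hφ
  have hinv := inversionIntegral_charFun_nonneg φ hφint x
  have hpeq := stableDensity_eq hφ x
  have hp0 : 0 ≤ p := by
    rw [hp, hpeq]
    exact mul_nonneg (by positivity) hinv.1
  have hpI : (p : ℂ) * (2 * Real.pi : ℝ) = inversionIntegral (charFun φ) x := by
    apply Complex.ext
    · rw [← Complex.ofReal_mul, Complex.ofReal_re, hp, hpeq]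
      field_simp
    · rw [← Complex.ofReal_mul, Complex.ofReal_im, hinv.2]
  have hbdd : ∀ σ : Measure ℝ, IsFiniteMeasure σ → Integrable (fejer a) σ := fun σ _ =>
    Integrable.of_bound (C := a ^ 2) (continuous_fejer a).aestronglyMeasurable
      (ae_of_all _ fun y => by
        rw [Real.norm_of_nonneg (fejer_nonneg a y)]
        exact fejer_le a y)
  have hmain := tendsto_real_of_tendsto_weighted_charFun (continuous_fejer a) (fejer_nonneg a)
    (νs := fun n => ENNReal.ofReal (B n) • P.map (T n)) (ν := ENNReal.ofReal p • volume)
    (fun n => (hbdd _ inferInstance).smul_measure ENNReal.ofReal_ne_top)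
    ((integrable_fejer ha0).smul_measure ENNReal.ofReal_ne_top) (by
      intro u
      rw [integral_smul_measure, ENNReal.toReal_ofReal hp0, integral_fejer_mul_exp ha0,
        Complex.real_smul, ← mul_assoc, hpI, mul_comm]
      refine (tendsto_integral_tri_mul_charFun_pow hc hα hαβ hφ hlattice hs hε hFourier hB hBtop
        ha0 u x).congr' ?_
      filter_upwards [hBtop.eventually_gt_atTop 0] with n hn
      rw [integral_smul_measure, ENNReal.toReal_ofReal hn.le, integral_fejer_mul_exp_eq ha0]
      have hsub := Measure.integral_comp_mul_right
        (fun t : ℝ => (tri a (t - u) : ℂ) * charFun (P.map (T n)) t) (1 / B n)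
      rw [one_div, inv_inv, abs_of_pos hn] at hsub
      rw [← hsub, one_div]
      refine integral_congr_ae (ae_of_all _ fun ξ => ?_)
      simp only [hT, charFun_map_sum_add_const hX hindep]
      congr 3
      push_cast
      ring) hC.measurableSet (by
      rw [Measure.smul_apply, hC.frontier_null, smul_zero]) hk (fun y hy => hKk y (hCr hy))
  rw [measureReal_ennreal_smul_apply, ENNReal.toReal_ofReal hp0] at hmain
  refine hmain.congr' ?_
  filter_upwards [hBtop.eventually_gt_atTop 0] with n hn
  rw [measureReal_ennreal_smul_apply, ENNReal.toReal_ofReal hn.le]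
  congr 1
  rw [measureReal_def, measureReal_def, Measure.map_apply_of_aemeasurable (hTm n) hC.measurableSet]
  congr 2
  ext ω
  simp only [Set.mem_preimage, Set.mem_ofPred_eq, Set.mem_image, hT]
  constructor
  · intro h
    exact ⟨_, h, by ring⟩
  · rintro ⟨y, hy, h⟩
    have hcancel : (n : ℝ) * m + B n * x + y + -((n : ℝ) * m + B n * x) = y := by ring
    rwa [← h, hcancel]

end StoneFeller

theorem mainTheorem5
    (c α β : ℝ) (hc : 0 < c) (hα : α ∈ Set.Ioc (0 : ℝ) 2) (hβ : β ∈ Set.Icc (-1 : ℝ) 1)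
    (hαβ : ¬ (α = 1 ∧ β ≠ 0))
    -- the stable law with parameters `(c, α, β)`
    (φ : Measure ℝ) [IsProbabilityMeasure φ] (hφ : StoneFeller.IsStableLaw φ c α β)
    -- the non-lattice law `μ`, in the domain of attraction of `φ`
    (μ : Measure ℝ) [IsProbabilityMeasure μ]
    (hlattice : ¬ StoneFeller.IsLatticeDistributed μ)
    (hattr : StoneFeller.InDomainOfAttraction μ φ)
    -- the form of its Fourier transform near the origin
    (m : ℝ) (s : ℝ → ℝ) (ε : ℝ → ℂ)
    (hs : StoneFeller.IsSlowlyVaryingAtZero s)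
    (hε : Tendsto ε (𝓝[≠] 0) (𝓝 0))
    (hFourier : ∀ᶠ ξ : ℝ in 𝓝 0, charFun μ ξ =
      Complex.exp (Complex.I * (m : ℂ) * (ξ : ℂ)
        - StoneFeller.stableSymbol c α β ξ * (s ξ : ℂ) * (1 + ε ξ)))
    -- the scaling constants
    (B : ℕ → ℝ) (hB : ∀ᶠ n : ℕ in atTop, B n ^ α = (n : ℝ) * s (1 / B n))
    (hBtop : Tendsto B atTop atTop)
    -- independent random variables with law `μ`
    {Ω : Type*} [MeasurableSpace Ω] (P : Measure Ω) [IsProbabilityMeasure P]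
    (X : ℕ → Ω → ℝ) (hX : ∀ i, HasLaw (X i) μ P) (hindep : iIndepFun X P) :
    StoneFeller.IsContinuousDensity (StoneFeller.stableDensity c α β) φ ∧
    ∀ (x : ℝ) (C : Set ℝ), StoneFeller.IsJordanMeasurable C →
      Tendsto
        (fun n : ℕ => B n * P.real {ω | ∑ i ∈ Finset.range n, X i ω ∈
          (fun y : ℝ => (n : ℝ) * m + B n * x + y) '' C})
        atTop (𝓝 (StoneFeller.stableDensity c α β x * volume.real C)) := by
  have hα0 : 0 < α := hα.1
  refine ⟨?_, fun x C hC => StoneFeller.tendsto_mul_measureReal_sum_mem hc hα0 hαβ hφ hlattice hs hε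
    hFourier hB hBtop hX hindep x hC⟩
  rw [show StoneFeller.stableDensity c α β = _ from funext (StoneFeller.stableDensity_eq hφ)]
  exact StoneFeller.isContinuousDensity_inversionIntegral φ
    (StoneFeller.integrable_charFun_of_isStableLaw hc hα0 hαβ hφ)
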